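/- **Theorem (space-discretization error).** Let $T>0$, $D=(0,1)$, $p\in\{2,3\}$, and let $\|\cdot\|$ and $(\cdot,\cdot)$ be the norm and inner product of $L^2(D)$. Put $\lambda_k=k\pi$ and $\varepsilon_k(x)=\sqrt2\,\sin(\lambda_k x)$ for $k\ge1$, and let $\dot{\bf H}^4(D)$ be the space of all $g\in L^2(D)$ with $\sum_{k\ge1}\lambda_k^{8}(g,\varepsilon_k)^2<\infty$. Derivatives $\partial_x^k$ are weak derivatives. Let $W$ be a space-time white noise on $[0,T]\times D$, defined on a probability space $(\Omega,\mathcal F,P)$. For positive integers ${\sf M}_\star$ and ${\sf N}_\star$ put $\Delta t=T/{\sf N}_\star$, $T_n=((n-1)\Delta t,n\Delta t)$, ${\sf R}^n_i=\int_{T_n}\int_D\varepsilon_i(x)\,dW(t,x)$, and $$\widehat W(t,x)=\frac1{\Delta t}\sum_{i=1}^{{\sf M}_\star}{\sf R}^n_i\,\varepsilon_i(x)\qquad (t\in T_n,\ x\in D,\ n=1,\dots,{\sf N}_\star).$$ For a positive integer $M$ put $\Delta\tau=T/M$ and $\Delta_m=((m-1)\Delta\tau,m\Delta\tau)$. The Crank–Nicolson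 time-discrete approximations $(U^m)_{m=0}^M$ are given by $U^0=0$ and, for $m=1,\dots,M$, $U^m\in\dot{\bf H}^4(D)$ with $$U^m-U^{m-1}+\tfrac{\Delta\tau}{2}\,\partial_x^4(U^m+U^{m-1})=\int_{\Delta_m}\widehat W\,ds\quad\text{a.s.}$$ Given a partition of $D$ into finitely many intervals with maximum mesh-length $h$, let ${\sf S}_h^p$ be a linear subspace of the space of all functions in $H^2(D)\cap H^1_0(D)$ that are polynomials of degree at most $p$ on each interval of the partition, which contains all those functions of that space that belong to $H^p(D)$ (for instance, the whole space, which for $p=2$ is the only choice). The Crank–Nicolson fully discrete approximations $(U_h^m)_{m=0}^M$ are given by $U_h^0=0$ and, for $m=1,\dots,M$, $U_h^m\in{\sf S}_h^p$ with, a.s., $$(U_h^m-U_h^{m-1},\chi)+\tfrac{\Delta\tau}{2}\left(\partial_x^2(U_h^m+U_h^{m-1}),\partial_x^2\chi\right)=\int_{\Delta_m}(\widehat W(s,\cdot),\chi)\,ds\qquad\forall\,\chi\in{\sf S}_h^p .$$ Then there is a constant $C>0$, depending only on $T$ and $p$ (in particular independent of ${\sf M}_\star$, $\Delta t$, $h$,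 the partition, ${\sf S}_h^p$, $\Delta\tau$, $\epsilon_1$ and $\epsilon_2$), such that $\|U_h^m-U^m\|^2$ is integrable for $1\le m\le M$ and $$\max_{1\le m\le M}\left(\mathbb E\left[\|U_h^m-U^m\|^2\right]\right)^{1/2}\le C\left(\epsilon_1^{-1/2}\,h^{\frac p2-\epsilon_1}+\epsilon_2^{-1/2}\,\Delta\tau^{\frac38-\epsilon_2}\right)\qquad\forall\,\epsilon_1\in\left(0,\tfrac p2\right],\ \forall\,\epsilon_2\in\left(0,\tfrac38\right].$$ -/

import Mathlib

open MeasureTheory Set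

namespace CNFEM

noncomputable section

/-! ### The function spaces on `D = (0,1)` -/

/-- Lebesgue measure on `D = (0,1)`. -/
abbrev volD : Measure ℝ := volume.restrict (Ioo (0 : ℝ) 1)

/-- The Hilbert space `L²(D)`; its norm is `‖·‖_{0,D}` and its inner product `(·,·)_{0,D}`. -/
abbrev L2D : Type := Lp ℝ 2 volD

/-- `lam k = k π`. -/
def lam (k : ℕ) : ℝ := k * Real.pi

/-- `eps k x = √2 sin(k π x)`, for `k ≥ 1` the Dirichlet eigenfunctions on `D`. -/
def eps (k : ℕ) (x : ℝ) : ℝ := Real.sqrt 2 * Real.sin (lam k * x)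

/-- `z` is the weak (generalized) derivative of order `k` of `g` on `D`:
`∫_D g φ⁽ᵏ⁾ = (-1)ᵏ ∫_D z φ` for every test function `φ ∈ C_c^∞(D)`. -/
def IsWeakDeriv (k : ℕ) (g z : L2D) : Prop :=
  ∀ φ : ℝ → ℝ, ContDiff ℝ (⊤ : ℕ∞) φ → HasCompactSupport φ → tsupport φ ⊆ Ioo (0 : ℝ) 1 →
    ∫ x in Ioo (0 : ℝ) 1, g x * iteratedDeriv k φ x =
      (-1) ^ k * ∫ x in Ioo (0 : ℝ) 1, z x * φ x

open Classical in
/-- `∂ₓᵏ g` as an element of `L²(D)`; the default value `0` is used only for those `g` that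
have no weak derivative of order `k` in `L²(D)`. -/
def weakDeriv (k : ℕ) (g : L2D) : L2D :=
  if h : ∃ z, IsWeakDeriv k g z then h.choose else 0

/-- Membership in the Sobolev space `H^s(D)`, `s ∈ ℕ₀`: all weak derivatives of order at most
`s` lie in `L²(D)`. -/
def MemH (s : ℕ) (g : L2D) : Prop := ∀ l ≤ s, ∃ z, IsWeakDeriv l g z

/-- Membership in `H¹₀(D)`: `g ∈ H¹(D)` vanishes at both endpoints in the sense of trace. In one
dimension the traces are the endpoint values of the representative that is continuous
on `[0,1]`. -/
def MemH10 (g : L2D) : Prop :=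
  MemH 1 g ∧ ∃ f : ℝ → ℝ, ContinuousOn f (Icc 0 1) ∧ (∀ᵐ x ∂volD, g x = f x) ∧
    f 0 = 0 ∧ f 1 = 0

/-- Membership in `Ḣ^s(D)`, `s ≥ 0`: `∑_{k ≥ 1} lam_k^{2s} (g, eps_k)²_{0,D} < ∞`. -/
def MemHdot (s : ℝ) (g : L2D) : Prop :=
  Summable fun k : ℕ =>
    lam (k + 1) ^ (2 * s) * (∫ x in Ioo (0 : ℝ) 1, g x * eps (k + 1) x) ^ 2

/-- The bilinear form `B(v₁, v₂) = (∂ₓ² v₁, ∂ₓ² v₂)_{0,D}` (used on `H²(D)` only). -/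
def bilB (v₁ v₂ : L2D) : ℝ := inner ℝ (weakDeriv 2 v₁) (weakDeriv 2 v₂)

/-! ### Finite element spaces -/

/-- A partition `0 = x_0 < x_1 < ⋯ < x_J = 1` of `D` into `J` intervals. -/
structure Mesh where
  J : ℕ
  node : Fin (J + 1) → ℝ
  strictMono : StrictMono node
  node_zero : node 0 = 0
  node_last : node (Fin.last J) = 1

/-- The maximum mesh-length `h` of a partition. -/
def Mesh.h (K : Mesh) : ℝ := ⨆ j : Fin K.J, (K.node j.succ - K.node j.castSucc)

/-- `g` is a piecewise polynomial of degree at most `p` over the partition `K`. -/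
def IsPiecewisePoly (p : ℕ) (K : Mesh) (g : L2D) : Prop :=
  ∀ j : Fin K.J, ∃ q : Polynomial ℝ, q.natDegree ≤ p ∧
    ∀ᵐ x ∂(volume.restrict (Ioo (K.node j.castSucc) (K.node j.succ))), g x = q.eval x

/-- `S` is a finite element subspace `S_h^p` of `H²(D) ∩ H¹₀(D)` of piecewise polynomials of
degree at most `p` over the partition `K`. It may consist of all such functions, or the
interelement smoothness may be raised, up to that of the splines of degree `p` (those in
`H^p(D)`, that is, in `C^{p-1}`), which `S` has to contain. For `p = 2` the only such `S` is the
full space. -/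
structure IsFESpace (p : ℕ) (K : Mesh) (S : Submodule ℝ L2D) : Prop where
  memH2 : ∀ χ ∈ S, MemH 2 χ
  memH10 : ∀ χ ∈ S, MemH10 χ
  piecewisePoly : ∀ χ ∈ S, IsPiecewisePoly p K χ
  splines_mem : ∀ χ : L2D, IsPiecewisePoly p K χ → MemH p χ → MemH10 χ → χ ∈ S

/-! ### Space-time white noise and the spectral load -/

/-- Lebesgue measure on `(0,T) × D`. -/
abbrev volO (T : ℝ) : Measure (ℝ × ℝ) := volume.restrict (Ioo 0 T ×ˢ Ioo (0 : ℝ) 1)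

/-- `W` is a space-time white noise on `[0,T] × D`, given as the family of its Wiener integrals
`W g = ∫_0^T ∫_D g(t,x) dW(t,x)`, `g ∈ L²((0,T) × D)`: the centred Gaussian process with
`E[W g₁ · W g₂] = (g₁, g₂)_{L²((0,T) × D)}`. In particular `W (1_A)` and `W (1_B)` are centred
Gaussian variables with covariance `|A ∩ B|`. -/
structure IsWhiteNoise (T : ℝ) {Ω : Type*} [MeasurableSpace Ω] (P : Measure Ω)
    (W : Lp ℝ 2 (volO T) → Ω → ℝ) : Prop where
  gaussian : ProbabilityTheory.IsGaussianProcess W P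
  mean_zero : ∀ g, ∫ ω, W g ω ∂P = 0
  covariance : ∀ g₁ g₂, ∫ ω, W g₁ ω * W g₂ ω ∂P = inner ℝ g₁ g₂

/-- The interval `((n-1) δ, n δ)`; with `δ = Δt` this is `T_n`, with `δ = Δτ` it is `Δ_m`. -/
def cell (δ : ℝ) (n : ℕ) : Set ℝ := Ioo (((n : ℝ) - 1) * δ) ((n : ℝ) * δ)

/-- The function `(t,x) ↦ 1_{T_n}(t) eps_i(x)`. -/
def mode (Δt : ℝ) (n i : ℕ) (z : ℝ × ℝ) : ℝ := (cell Δt n).indicator (fun _ => eps i z.2) z.1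

lemma memLp_mode (T Δt : ℝ) (n i : ℕ) : MemLp (mode Δt n i) 2 (volO T) := by
  have hfin : IsFiniteMeasure (volO T) := by
    refine ⟨?_⟩
    rw [Measure.restrict_apply_univ, Measure.volume_eq_prod, Measure.prod_prod,
      Real.volume_Ioo, Real.volume_Ioo]
    exact ENNReal.mul_lt_top ENNReal.ofReal_lt_top ENNReal.ofReal_lt_top
  have hmeas : Measurable (mode Δt n i) := by
    have h1 : mode Δt n i =
        (Prod.fst ⁻¹' (cell Δt n)).indicator (fun z : ℝ × ℝ => eps i z.2) := by
      funext z
      by_cases hz : z.1 ∈ cell Δt n <;> simp [mode, indicator, hz]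
    rw [h1]
    refine Measurable.indicator ?_ (measurable_fst measurableSet_Ioo)
    unfold eps
    fun_prop
  refine MemLp.of_bound hmeas.aestronglyMeasurable (Real.sqrt 2) (Filter.Eventually.of_forall ?_)
  intro z
  refine (norm_indicator_le_norm_self _ _).trans ?_
  rw [eps, norm_mul, Real.norm_eq_abs, Real.norm_eq_abs, abs_of_nonneg (Real.sqrt_nonneg 2)]
  exact mul_le_of_le_one_right (Real.sqrt_nonneg 2) (Real.abs_sin_le_one _)

/-- `R^n_i = ∫_{T_n} ∫_D eps_i(x) dW(t,x)`. -/
def noiseCoeff (T : ℝ) {Ω : Type*} (W : Lp ℝ 2 (volO T) → Ω → ℝ) (Δt : ℝ) (n i : ℕ) (ω : Ω) : ℝ :=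
  W ((memLp_mode T Δt n i).toLp (mode Δt n i)) ω

/-- The load `Ŵ(t,x)`: on `T_n`, `n = 1, …, Nstar`, it equals
`(1/Δt) ∑_{i=1}^{Mstar} R^n_i eps_i(x)`, with `Δt = T / Nstar`. -/
def load (T : ℝ) {Ω : Type*} (W : Lp ℝ 2 (volO T) → Ω → ℝ) (Mstar Nstar : ℕ) (ω : Ω)
    (t x : ℝ) : ℝ :=
  ∑ n ∈ Finset.Icc 1 Nstar, (cell (T / Nstar) n).indicator
    (fun _ => (1 / (T / Nstar)) *
      ∑ i ∈ Finset.Icc 1 Mstar, noiseCoeff T W (T / Nstar) n i ω * eps i x) t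

/-! ### The Crank–Nicolson approximations -/

/-- `U` are the Crank–Nicolson time-discrete approximations on the uniform partition of `[0,T]`
of width `Δτ = T / M`: almost surely `U^0 = 0` and, for `m = 1, …, M`, `U^m ∈ Ḣ⁴(D)` and
`U^m - U^{m-1} + Δτ ∂ₓ⁴ ((U^m + U^{m-1})/2) = ∫_{Δ_m} Ŵ ds` in `L²(D)`. -/
def IsTimeDiscrete (T : ℝ) {Ω : Type*} [MeasurableSpace Ω] (P : Measure Ω)
    (W : Lp ℝ 2 (volO T) → Ω → ℝ) (Mstar Nstar M : ℕ) (U : ℕ → Ω → L2D) : Prop :=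
  ∀ᵐ ω ∂P, U 0 ω = 0 ∧ ∀ m ∈ Finset.Icc 1 M,
    MemHdot 4 (U m ω) ∧
    ∀ᵐ x ∂volD,
      (U m ω - U (m - 1) ω + (T / M) • weakDeriv 4 ((1 / 2 : ℝ) • (U m ω + U (m - 1) ω))) x
        = ∫ s in cell (T / M) m, load T W Mstar Nstar ω s x

/-- `U` are the Crank–Nicolson fully discrete approximations in `S`, with `Δτ = T / M`: almost
surely `U^0 = 0` and, for `m = 1, …, M`, `U^m ∈ S` and, for all `χ ∈ S`,
`(U^m - U^{m-1}, χ) + (Δτ/2) B(U^m + U^{m-1}, χ) = ∫_{Δ_m} (Ŵ(s,·), χ) ds`. -/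
def IsFullyDiscrete (T : ℝ) {Ω : Type*} [MeasurableSpace Ω] (P : Measure Ω)
    (W : Lp ℝ 2 (volO T) → Ω → ℝ) (Mstar Nstar M : ℕ) (S : Submodule ℝ L2D)
    (U : ℕ → Ω → L2D) : Prop :=
  ∀ᵐ ω ∂P, U 0 ω = 0 ∧ ∀ m ∈ Finset.Icc 1 M,
    U m ω ∈ S ∧
    ∀ χ ∈ S,
      inner ℝ (U m ω - U (m - 1) ω) χ + (T / M) / 2 * bilB (U m ω + U (m - 1) ω) χ
        = ∫ s in cell (T / M) m, ∫ x in Ioo (0 : ℝ) 1, load T W Mstar Nstar ω s x * χ x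

end

end CNFEM

/-!
# The error of the Crank–Nicolson finite element method against its time-discrete counterpart

The operator `∂ₓ⁴` with the boundary conditions `u = u'' = 0` is the square of `-∂ₓ²` with
Dirichlet conditions. Let `G` be the solution operator of `u'' = f`, `u(0) = u(1) = 0`, built from
the primitive operator `primL` and the projection `Q0` onto the functions of mean zero. Every
function of `H²(D) ∩ H¹₀(D)` is `G` of its second weak derivative (`eq_G_weakDeriv`), so that the
solution operator of the fourth order problem is `G²`, and that of its Galerkin approximation in
`S` is `G ∘ projS S ∘ G`, where `projS S` is the `L²(D)` projection onto the (closed) space of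
second derivatives of the functions in `S`. Both are of the form `gram K = K† K`. In one space
dimension no boundary condition is imposed on the second derivatives of finite element functions,
hence they contain all piecewise constants (`p = 2`), or the primitives of all piecewise constants
(`p = 3`), and elliptic error bounds reduce to approximation by piecewise constants and duality
(`IsFESpace.approx`, `IsFESpace.norm_elliptic_error_le`): the error of the elliptic projection of
`eps k` is at most `h ^ p * lam k ^ 3`.

After application of the solution operator both schemes read `gram K (U^m - U^{m-1} - F_m) +
(Δτ/2) (U^m + U^{m-1}) = 0`, with `F_m` the integral of the load. For the time-discrete scheme
this uses the completeness of the sine system (`eq_zero_of_forall_inner_sinL`), by which a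
function in `Ḣ⁴(D)` is `G²` of its fourth weak derivative. Duhamel's formula `cn_solution` and
Itô's isometry `IsWhiteNoise.isometry` then bound the mean square error by the sum over the modes
`i` of `Δτ ∑_j ‖b_j - a_j‖²`, where `b` and `a` are the orbits of the two schemes with the single
load `eps i` in the first step (`sum_overlap_norm_sq_le`).

For each mode (`sum_error_le`), energy estimates that lose no power of `Δτ` give three bounds,
with `μ = lam i ^ 4`. By stability, `Δτ ∑ ‖b_j - a_j‖² ≤ 4 / μ`. By consistency, the averages of
the error at consecutive times are of size `h ^ p * lam i` in `ℓ²` of time. Finally, an orbit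
differs from its averages by its increments, and `∑ ‖b_{j+1} - b_j‖² ≤ 1 / (1 + Δτ μ / 2)`. The
sum over `i` of the minimum of the first two bounds is of order `h ^ p`, and the sum of the last
one, times `Δτ`, is of order `Δτ ^ (3/4)` (`sum_mode_error_le`). So the mean square error obeys `E
‖U_h^m - U^m‖² ≤ 64 h ^ p + 8 Δτ ^ (3/4)` (`mean_square_error_le`), which is stronger than the
assertion, since `h ≤ 1`, `Δτ ≤ T`, and `ε₁`, `ε₂` are bounded.
-/

namespace CNFEM

noncomputable section

/-! ### Crank–Nicolson orbits in a Hilbert space -/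

section Orbits

lemma parallelogram_sq {H : Type*} [NormedAddCommGroup H] [InnerProductSpace ℝ H] (x y : H) :
    ‖x‖ ^ 2 + ‖y‖ ^ 2 = 1 / 2 * ‖x + y‖ ^ 2 + 1 / 2 * ‖x - y‖ ^ 2 := by
  rw [norm_add_sq_real, norm_sub_sq_real]; ring

variable {H : Type*} [NormedAddCommGroup H] [InnerProductSpace ℝ H] [CompleteSpace H]

/-- The positive operator `K† K`. With `K` the (projected) Dirichlet solution operator, this is the
(discrete) solution operator of the fourth order boundary value problem. -/
def gram (K : H →L[ℝ] H) : H →L[ℝ] H := (ContinuousLinearMap.adjoint K).comp K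

lemma inner_gram (K : H →L[ℝ] H) (x y : H) : inner ℝ (gram K x) y = inner ℝ (K x) (K y) := by
  simp [gram, ContinuousLinearMap.adjoint_inner_left]

/-- `b` is the orbit of the Crank–Nicolson scheme with solution operator `gram K` and step `k` that
answers to a single load `f` in the first step. The scheme is written after application of
the solution operator, so that it makes sense for every vector. -/
structure IsCNOrbit (K : H →L[ℝ] H) (k : ℝ) (f : H) (b : ℕ → H) : Prop where
  init : gram K (b 0) + (k / 2) • b 0 = gram K f
  step : ∀ j, gram K (b (j + 1) - b j) + (k / 2) • (b (j + 1) + b j) = 0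

lemma gram_add_smul_injective (K : H →L[ℝ] H) {c : ℝ} (hc : 0 < c) {x : H}
    (h : gram K x + c • x = 0) : x = 0 := by
  have h1 : inner ℝ (gram K x + c • x) x = 0 := by rw [h, inner_zero_left]
  rw [inner_add_left, inner_gram, real_inner_smul_left, real_inner_self_eq_norm_sq,
    real_inner_self_eq_norm_sq] at h1
  have h2 : ‖x‖ ^ 2 = 0 := by nlinarith [sq_nonneg ‖K x‖, sq_nonneg ‖x‖]
  simpa using h2

lemma exists_gram_add_smul_inverse (K : H →L[ℝ] H) {c : ℝ} (hc : 0 < c) :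
    ∃ A : H →L[ℝ] H, ∀ x, gram K (A x) + c • A x = x := by
  let L : H →L[ℝ] H := gram K + c • ContinuousLinearMap.id ℝ H
  let B : H →L[ℝ] H →L[ℝ] ℝ :=
    (isBoundedBilinearMap_inner (𝕜 := ℝ) (E := H)).toContinuousLinearMap.comp L
  have hB : ∀ x y, B x y = inner ℝ (L x) y := fun x y => rfl
  have hco : IsCoercive B := by
    refine ⟨c, hc, fun u => ?_⟩
    rw [hB]
    simp only [L, add_apply, smul_apply,
      ContinuousLinearMap.id_apply, inner_add_left, inner_gram, real_inner_smul_left,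
      real_inner_self_eq_norm_sq]
    nlinarith [sq_nonneg ‖K u‖]
  -- The theorem of Lax and Milgram for the form `⟪(K† K + c) x, y⟫`.
  refine ⟨hco.continuousLinearEquivOfBilin.symm, fun x => ?_⟩
  set z := hco.continuousLinearEquivOfBilin.symm x with hz
  have hzx : hco.continuousLinearEquivOfBilin z = x := by simp [hz]
  change L z = x
  refine ext_inner_right ℝ fun w => ?_
  rw [← hB, ← hco.continuousLinearEquivOfBilin_apply, hzx]

/-- The one-step operators of the Crank–Nicolson scheme: `R = (T + k/2)⁻¹ T` acts on the load and
`Q = (T + k/2)⁻¹ (T - k/2)` propagates. -/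
lemma exists_cn_operators (K : H →L[ℝ] H) {k : ℝ} (hk : 0 < k) :
    ∃ R Q : H →L[ℝ] H, (∀ x, gram K (R x) + (k / 2) • R x = gram K x) ∧
      ∀ x, gram K (Q x - x) + (k / 2) • (Q x + x) = 0 := by
  obtain ⟨A, hA⟩ := exists_gram_add_smul_inverse K (half_pos hk)
  refine ⟨A.comp (gram K), A.comp (gram K - (k / 2) • ContinuousLinearMap.id ℝ H),
    fun x => hA _, fun x => ?_⟩
  have := hA ((gram K - (k / 2) • ContinuousLinearMap.id ℝ H) x)
  simp only [ContinuousLinearMap.comp_apply, map_sub, smul_add]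
  rw [sub_add_eq_add_sub, ← add_assoc, this]
  simp

lemma isCNOrbit_pow {K : H →L[ℝ] H} {k : ℝ} {R Q : H →L[ℝ] H}
    (hR : ∀ x, gram K (R x) + (k / 2) • R x = gram K x)
    (hQ : ∀ x, gram K (Q x - x) + (k / 2) • (Q x + x) = 0) (f : H) :
    IsCNOrbit K k f (fun j => (Q ^ j) (R f)) :=
  ⟨by simpa using hR f, fun j => by simpa [pow_succ'] using hQ ((Q ^ j) (R f))⟩

/-- Duhamel's formula for the Crank–Nicolson scheme. -/
lemma cn_solution {K : H →L[ℝ] H} {k : ℝ} (hk : 0 < k) {R Q : H →L[ℝ] H}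
    (hR : ∀ x, gram K (R x) + (k / 2) • R x = gram K x)
    (hQ : ∀ x, gram K (Q x - x) + (k / 2) • (Q x + x) = 0) {M : ℕ} {V F : ℕ → H} (h0 : V 0 = 0)
    (hV : ∀ m, m < M →
      gram K (V (m + 1) - V m - F (m + 1)) + (k / 2) • (V (m + 1) + V m) = 0) :
    ∀ m ≤ M, V m = ∑ l ∈ Finset.Icc 1 m, (Q ^ (m - l)) (R (F l)) := by
  intro m
  induction m with
  | zero => intro _; simpa using h0
  | succ m ih =>
    intro hm
    have h1 : V (m + 1) = Q (V m) + R (F (m + 1)) := by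
      rw [← sub_eq_zero]
      refine gram_add_smul_injective K (half_pos hk) ?_
      have e1 := hV m hm
      have e2 := hQ (V m)
      have e3 := hR (F (m + 1))
      simp only [map_sub, map_add, smul_sub, smul_add] at e1 e2 e3 ⊢
      linear_combination (norm := module) e1 - e2 - e3
    rw [h1, ih (by omega), Finset.sum_Icc_succ_top (by omega), map_sum]
    congr 1
    · refine Finset.sum_congr rfl fun l hl => ?_
      rw [Finset.mem_Icc] at hl
      rw [show m + 1 - l = (m - l) + 1 by omega, pow_succ']
      rfl
    · simp

/-- An orbit lies in the range of `K†`, and its lift `y` there obeys the scheme as well. The lift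
carries the energy of the orbit. -/
lemma IsCNOrbit.exists_lift {K : H →L[ℝ] H} {k : ℝ} (hk : 0 < k) {f : H} {b : ℕ → H}
    (hb : IsCNOrbit K k f b) :
    ∃ y : ℕ → H, (∀ j, b j = ContinuousLinearMap.adjoint K (y j)) ∧
      K (b 0) + (k / 2) • y 0 = K f ∧
      ∀ j, K (b (j + 1) - b j) + (k / 2) • (y (j + 1) + y j) = 0 := by
  let y : ℕ → H := fun j => Nat.rec ((2 / k) • K (f - b 0))
    (fun j yj => -yj - (2 / k) • K (b (j + 1) - b j)) j
  have y0 : y 0 = (2 / k) • K (f - b 0) := rfl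
  have ys : ∀ j, y (j + 1) = -y j - (2 / k) • K (b (j + 1) - b j) := fun j => rfl
  have hk2 : (k / 2) * (2 / k) = 1 := by field_simp
  have hk3 : (2 / k) * (k / 2) = 1 := by field_simp
  have hT : ∀ x, ContinuousLinearMap.adjoint K (K x) = gram K x := fun x => rfl
  refine ⟨y, fun j => ?_, ?_, fun j => ?_⟩
  · induction j with
    | zero =>
      have h1 : gram K (f - b 0) = (k / 2) • b 0 := by
        rw [map_sub, ← hb.init]; abel
      rw [y0, map_smul, hT, h1, smul_smul, hk3, one_smul]
    | succ j ih =>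
      have h1 : gram K (b (j + 1) - b j) = -((k / 2) • (b (j + 1) + b j)) :=
        eq_neg_of_add_eq_zero_left (hb.step j)
      rw [ys, map_sub, map_neg, ← ih, map_smul, hT, h1, smul_neg, smul_smul, hk3, one_smul]
      abel
  · rw [y0, smul_smul, hk2, one_smul, map_sub]; abel
  · rw [ys, neg_sub_left, neg_add_eq_sub, sub_add_cancel_right, smul_neg, smul_smul, hk2, one_smul,
      add_neg_cancel]

/-- The initial energy of the lift is controlled by the load. -/
lemma IsCNOrbit.init_bounds {K : H →L[ℝ] H} {k : ℝ} (hk : 0 < k) {f : H} {b : ℕ → H} {y₀ : H}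
    (hb : b 0 = ContinuousLinearMap.adjoint K y₀) (hy : K (b 0) + (k / 2) • y₀ = K f) :
    ‖K (b 0)‖ ^ 2 + k ^ 2 / 4 * ‖y₀‖ ^ 2 ≤ ‖K f‖ ^ 2 ∧
      ‖b 0‖ ^ 2 + k / 2 * ‖y₀‖ ^ 2 = inner ℝ f (b 0) := by
  have h1 : inner ℝ (K (b 0)) y₀ = ‖b 0‖ ^ 2 := by
    rw [← ContinuousLinearMap.adjoint_inner_right, ← hb, real_inner_self_eq_norm_sq]
  constructor
  · rw [← hy, norm_add_sq_real, real_inner_smul_right, h1, norm_smul, mul_pow, Real.norm_eq_abs,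
      sq_abs]
    nlinarith [sq_nonneg ‖b 0‖]
  · have h2 : inner ℝ (K f) y₀ = inner ℝ f (b 0) := by
      rw [hb, ContinuousLinearMap.adjoint_inner_right]
    rw [← h2, ← hy, inner_add_left, h1, real_inner_smul_left, real_inner_self_eq_norm_sq]

/-- Smoothing: the midpoint values of an orbit are square summable in time, with a bound in
the negative norm `‖K f‖`. -/
lemma IsCNOrbit.sum_midpoint {K : H →L[ℝ] H} {k : ℝ} {f : H} {b : ℕ → H}
    (hb : IsCNOrbit K k f b) (n : ℕ) :
    ‖K (b n)‖ ^ 2 + k / 2 * ∑ j ∈ Finset.range n, ‖b (j + 1) + b j‖ ^ 2 = ‖K (b 0)‖ ^ 2 := by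
  induction n with
  | zero => simp
  | succ n ih =>
    have h1 : inner ℝ (gram K (b (n + 1) - b n) + (k / 2) • (b (n + 1) + b n))
        (b (n + 1) + b n) = 0 := by rw [hb.step, inner_zero_left]
    rw [inner_add_left, inner_gram, real_inner_smul_left, real_inner_self_eq_norm_sq, map_sub,
      map_add, inner_sub_left, inner_add_right, inner_add_right, real_inner_self_eq_norm_sq,
      real_inner_self_eq_norm_sq, real_inner_comm (K (b (n + 1))) (K (b n))] at h1
    rw [Finset.sum_range_succ, ← ih]
    linarith

/-- The increments of an orbit are square summable, with a bound by the energy of the lift. -/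
lemma sum_increment_of_lift {K : H →L[ℝ] H} {k : ℝ} {b y : ℕ → H}
    (hb : ∀ j, b j = ContinuousLinearMap.adjoint K (y j))
    (hy : ∀ j, K (b (j + 1) - b j) + (k / 2) • (y (j + 1) + y j) = 0) (n : ℕ) :
    k / 2 * ‖y n‖ ^ 2 + ∑ j ∈ Finset.range n, ‖b (j + 1) - b j‖ ^ 2 = k / 2 * ‖y 0‖ ^ 2 := by
  induction n with
  | zero => simp
  | succ n ih =>
    have h1 : inner ℝ (K (b (n + 1) - b n) + (k / 2) • (y (n + 1) + y n))
        (y (n + 1) - y n) = 0 := by rw [hy, inner_zero_left]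
    rw [inner_add_left, ← ContinuousLinearMap.adjoint_inner_right, map_sub, ← hb, ← hb,
      real_inner_self_eq_norm_sq, real_inner_smul_left, inner_sub_right, inner_add_left,
      inner_add_left, real_inner_self_eq_norm_sq, real_inner_self_eq_norm_sq,
      real_inner_comm (y (n + 1)) (y n)] at h1
    rw [Finset.sum_range_succ, ← ih]
    linarith

/-- The bound does not depend on the step: no power of `k` is lost in this stability estimate. -/
lemma IsCNOrbit.sum_sq_le {K : H →L[ℝ] H} {k : ℝ} (hk : 0 < k) {f : H} {b : ℕ → H}
    (hb : IsCNOrbit K k f b) (n : ℕ) :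
    k * ∑ j ∈ Finset.range n, (‖b (j + 1)‖ ^ 2 + ‖b j‖ ^ 2) ≤ ‖K f‖ ^ 2 := by
  obtain ⟨y, hy, hy0, hys⟩ := hb.exists_lift hk
  have h1 := hb.sum_midpoint n
  have h2 := sum_increment_of_lift hy hys n
  have h3 := (IsCNOrbit.init_bounds hk (hy 0) hy0).1
  simp_rw [parallelogram_sq]
  rw [Finset.sum_add_distrib, ← Finset.mul_sum, ← Finset.mul_sum]
  nlinarith [sq_nonneg ‖K (b n)‖, mul_nonneg hk.le (mul_nonneg hk.le (sq_nonneg ‖y n‖))]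

lemma IsCNOrbit.sum_increment_le {K : H →L[ℝ] H} {k : ℝ} (hk : 0 < k) {f : H} {b : ℕ → H}
    (hb : IsCNOrbit K k f b) (hf : ‖f‖ = 1) {μ : ℝ} (hμ : 0 < μ) (hK : ‖K f‖ ^ 2 ≤ μ⁻¹) (n : ℕ) :
    ∑ j ∈ Finset.range n, ‖b (j + 1) - b j‖ ^ 2 ≤ 1 / (1 + k * μ / 2) := by
  obtain ⟨y, hy, hy0, hys⟩ := hb.exists_lift hk
  have h2 := sum_increment_of_lift hy hys n
  have h3 := (IsCNOrbit.init_bounds hk (hy 0) hy0).2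
  set t := inner ℝ f (b 0) with ht
  have hb0 : t ^ 2 ≤ ‖b 0‖ ^ 2 := by
    have := abs_real_inner_le_norm f (b 0)
    rw [hf, one_mul] at this
    exact sq_le_sq' (by linarith [abs_le.1 this]) (abs_le.1 this).2
  have hy0' : μ * t ^ 2 ≤ ‖y 0‖ ^ 2 := by
    have h4 : t = inner ℝ (K f) (y 0) := by
      rw [ht, hy 0, ContinuousLinearMap.adjoint_inner_right]
    have h5 : t ^ 2 ≤ (‖K f‖ * ‖y 0‖) ^ 2 := by
      rw [h4]
      exact sq_le_sq' (by linarith [abs_le.1 (abs_real_inner_le_norm (K f) (y 0))])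
        (abs_le.1 (abs_real_inner_le_norm (K f) (y 0))).2
    rw [mul_pow] at h5
    have h6 : t ^ 2 ≤ μ⁻¹ * ‖y 0‖ ^ 2 :=
      h5.trans (mul_le_mul_of_nonneg_right hK (sq_nonneg _))
    calc μ * t ^ 2 ≤ μ * (μ⁻¹ * ‖y 0‖ ^ 2) := mul_le_mul_of_nonneg_left h6 hμ.le
      _ = ‖y 0‖ ^ 2 := by field_simp
  -- `t` is the resolvent of the operator in the state `f`, bounded as on an eigenvector.
  have ht1 : (1 + k * μ / 2) * t ^ 2 ≤ t := by nlinarith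
  have hpos : 0 < 1 + k * μ / 2 := by positivity
  have ht2 : t ≤ 1 / (1 + k * μ / 2) := by
    rw [le_div_iff₀ hpos]
    by_contra! hcon
    have : 0 < t := by
      by_contra! h; nlinarith
    nlinarith
  have : k / 2 * ‖y 0‖ ^ 2 ≤ t := by nlinarith [sq_nonneg ‖b 0‖]
  nlinarith [mul_nonneg hk.le (sq_nonneg ‖y n‖)]

/-- On an eigenvector the orbit stays on the line through the load. -/
lemma IsCNOrbit.exists_scalar {K : H →L[ℝ] H} {k : ℝ} (hk : 0 < k) {f : H} {a : ℕ → H}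
    (ha : IsCNOrbit K k f a) {μ : ℝ} (hμ : 0 < μ) (hf : gram K f = μ⁻¹ • f) :
    ∃ α : ℕ → ℝ, (∀ j, a j = α j • f) ∧ (1 - α 0 = k * μ / 2 * α 0) ∧
      ∀ j, α (j + 1) - α j = -(k * μ / 2 * (α (j + 1) + α j)) := by
  have hpos : 0 < 1 + k * μ / 2 := by positivity
  let r : ℝ := 1 / (1 + k * μ / 2)
  let q : ℝ := (1 - k * μ / 2) / (1 + k * μ / 2)
  have e0 : 1 - r = k * μ / 2 * r := by simp only [r]; field_simp; ring
  have es : ∀ j : ℕ, r * q ^ (j + 1) - r * q ^ j =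
      -(k * μ / 2 * (r * q ^ (j + 1) + r * q ^ j)) := by
    intro j
    have : q - 1 = -(k * μ / 2 * (q + 1)) := by simp only [q]; field_simp; ring
    rw [pow_succ]
    linear_combination (r * q ^ j) * this
  refine ⟨fun j => r * q ^ j, fun j => ?_, by simpa using e0, es⟩
  have hμ' : μ⁻¹ * μ = 1 := inv_mul_cancel₀ hμ.ne'
  induction j with
  | zero =>
    rw [← sub_eq_zero]
    refine gram_add_smul_injective K (half_pos hk) ?_
    have h1 := ha.init
    rw [hf] at h1
    simp only [map_sub, map_smul, hf, smul_sub, smul_smul, pow_zero, mul_one]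
    have h2 : r * μ⁻¹ + k / 2 * r = μ⁻¹ := by
      linear_combination (-μ⁻¹) * e0 - (k / 2 * r) * hμ'
    calc _ = gram K (a 0) + (k / 2) • a 0 - (r * μ⁻¹ + k / 2 * r) • f := by
          rw [add_smul]; abel
      _ = 0 := by rw [h1, h2, sub_self]
  | succ j ih =>
    rw [← sub_eq_zero]
    refine gram_add_smul_injective K (half_pos hk) ?_
    have h1 := ha.step j
    rw [ih] at h1
    simp only [map_sub, map_smul, hf, smul_sub, smul_add, smul_smul] at h1 ⊢
    have h2 : r * q ^ (j + 1) * μ⁻¹ + k / 2 * (r * q ^ (j + 1))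
        = r * q ^ j * μ⁻¹ - k / 2 * (r * q ^ j) := by
      linear_combination μ⁻¹ * es j - (k / 2 * (r * q ^ (j + 1) + r * q ^ j)) * hμ'
    calc _ = (gram K (a (j + 1)) - (r * q ^ j * μ⁻¹) • f
          + ((k / 2) • a (j + 1) + (k / 2 * (r * q ^ j)) • f))
          + (r * q ^ j * μ⁻¹ - k / 2 * (r * q ^ j)) • f
          - (r * q ^ (j + 1) * μ⁻¹ + k / 2 * (r * q ^ (j + 1))) • f := by
          rw [sub_smul, add_smul]; abel
      _ = 0 := by rw [h1, h2]; abel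

/-- Consistency: for an eigenvector of `gram K'`, the midpoint values of the difference of the two
orbits are controlled by the elliptic error `f - μ • gram K f`. -/
lemma sum_midpoint_error {K K' : H →L[ℝ] H} {k : ℝ} (hk : 0 < k) {f : H} {a b : ℕ → H}
    (hb : IsCNOrbit K k f b) (ha : IsCNOrbit K' k f a) (hf1 : ‖f‖ = 1) {μ : ℝ} (hμ : 0 < μ)
    (hf : gram K' f = μ⁻¹ • f) (n : ℕ) :
    k * ∑ j ∈ Finset.range n, ‖(b (j + 1) - a (j + 1)) + (b j - a j)‖ ^ 2
      ≤ 3 * (‖f - μ • gram K f‖ ^ 2 / μ) := by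
  have hK' : ‖K' f‖ ^ 2 = μ⁻¹ := by
    rw [← real_inner_self_eq_norm_sq, ← inner_gram, hf, real_inner_smul_left,
      real_inner_self_eq_norm_sq, hf1]; ring
  obtain ⟨α, hα, hα0, hαs⟩ := ha.exists_scalar hk hμ hf
  have hαn : ∀ j, ‖a j‖ ^ 2 = α j ^ 2 := fun j => by
    rw [hα, norm_smul, hf1, mul_one, Real.norm_eq_abs, sq_abs]
  have hsum : k * ∑ j ∈ Finset.range n, (α (j + 1) + α j) ^ 2 ≤ 2 * μ⁻¹ := by
    have h1 := ha.sum_sq_le hk n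
    simp only [hαn, hK'] at h1
    calc _ ≤ k * ∑ j ∈ Finset.range n, 2 * (α (j + 1) ^ 2 + α j ^ 2) := by
          refine mul_le_mul_of_nonneg_left (Finset.sum_le_sum fun j _ => ?_) hk.le
          nlinarith [sq_nonneg (α (j + 1) - α j)]
      _ ≤ 2 * μ⁻¹ := by rw [← Finset.mul_sum]; linarith
  have hα0' : k * α 0 ^ 2 ≤ μ⁻¹ := by
    have h1 := ha.sum_sq_le hk 1
    simp only [hαn, hK', Finset.sum_range_one] at h1
    nlinarith [mul_nonneg hk.le (sq_nonneg (α 1))]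
  set ρ := f - μ • gram K f with hρ
  set e : ℕ → H := fun j => b j - a j with he
  have e0 : gram K (e 0) + (k / 2) • e 0 = -((k / 2 * α 0) • ρ) := by
    have h1 := hb.init
    have h2 : gram K (e 0) + (k / 2) • e 0
        = gram K (b 0) + (k / 2) • b 0 - α 0 • gram K f - (k / 2 * α 0) • f := by
      simp only [he, hα, map_sub, map_smul, smul_sub, smul_smul]; abel
    rw [h2, h1, hρ, smul_sub, smul_smul]
    have h3 : gram K f - α 0 • gram K f = (k / 2 * α 0 * μ) • gram K f := by
      rw [show k / 2 * α 0 * μ = 1 - α 0 by rw [hα0]; ring, sub_smul, one_smul]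
    rw [h3]; abel
  have es : ∀ j, gram K (e (j + 1) - e j) + (k / 2) • (e (j + 1) + e j)
      = -((k / 2 * (α (j + 1) + α j)) • ρ) := by
    intro j
    have h1 := hb.step j
    have h2 : gram K (e (j + 1) - e j) + (k / 2) • (e (j + 1) + e j)
        = (gram K (b (j + 1) - b j) + (k / 2) • (b (j + 1) + b j))
          - (α (j + 1) - α j) • gram K f - (k / 2 * (α (j + 1) + α j)) • f := by
      simp only [he, hα, map_sub, map_smul, smul_sub, smul_add, smul_smul, sub_smul, add_smul,
        mul_add]
      abel
    rw [h2, h1, hρ, smul_sub, smul_smul, hαs]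
    rw [show k / 2 * (α (j + 1) + α j) * μ = k * μ / 2 * (α (j + 1) + α j) by ring, neg_smul]
    abel
  -- Young's inequality, with weights that let the left-hand side absorb the first term.
  have hyoung : ∀ (c : ℝ) (x : H), -(k / 2 * c * inner ℝ ρ x) ≤
      k / 4 * ‖x‖ ^ 2 + k / 4 * (c ^ 2 * ‖ρ‖ ^ 2) := by
    intro c x
    have h1 : 0 ≤ ‖c • ρ + x‖ ^ 2 := sq_nonneg _
    rw [norm_add_sq_real, norm_smul, mul_pow, Real.norm_eq_abs, sq_abs, real_inner_smul_left] at h1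
    nlinarith
  have hinit : ‖K (e 0)‖ ^ 2 ≤ k / 4 * (α 0 ^ 2 * ‖ρ‖ ^ 2) := by
    have h1 := congrArg (fun z => inner ℝ z (e 0)) e0
    simp only [inner_add_left, inner_gram, real_inner_smul_left, real_inner_self_eq_norm_sq,
      inner_neg_left] at h1
    have := hyoung (α 0) (e 0)
    nlinarith [mul_nonneg hk.le (sq_nonneg ‖e 0‖)]
  have hmain : ∀ n, ‖K (e n)‖ ^ 2 + k / 4 * ∑ j ∈ Finset.range n, ‖e (j + 1) + e j‖ ^ 2 ≤
      ‖K (e 0)‖ ^ 2 + k / 4 * ((∑ j ∈ Finset.range n, (α (j + 1) + α j) ^ 2) * ‖ρ‖ ^ 2) := by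
    intro n
    induction n with
    | zero => simp
    | succ n ih =>
      have h1 := congrArg (fun z => inner ℝ z (e (n + 1) + e n)) (es n)
      simp only [inner_neg_left] at h1
      rw [inner_add_left, inner_gram, real_inner_smul_left, real_inner_smul_left,
        real_inner_self_eq_norm_sq, map_sub, map_add, inner_sub_left, inner_add_right,
        inner_add_right, real_inner_self_eq_norm_sq, real_inner_self_eq_norm_sq,
        real_inner_comm (K (e (n + 1))) (K (e n))] at h1
      have := hyoung (α (n + 1) + α n) (e (n + 1) + e n)
      rw [Finset.sum_range_succ, Finset.sum_range_succ]
      linarith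
  have h1 := hmain n
  have hρ2 := sq_nonneg ‖ρ‖
  have h2 := mul_le_mul_of_nonneg_right hsum hρ2
  have h3 := mul_le_mul_of_nonneg_right hα0' hρ2
  rw [div_eq_mul_inv]
  change k * ∑ j ∈ Finset.range n, ‖e (j + 1) + e j‖ ^ 2 ≤ _
  nlinarith [sq_nonneg ‖K (e n)‖, mul_nonneg (inv_nonneg.2 hμ.le) hρ2]

/-- The error of the Galerkin orbit against the exact one, for an eigenvector as load, in `ℓ²` of
time. The midpoint values carry the consistency error; the values themselves differ from them by the
increments, which yields the last term. -/
theorem sum_error_le {K K' : H →L[ℝ] H} {k : ℝ} (hk : 0 < k) {f : H} {a b : ℕ → H}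
    (hb : IsCNOrbit K k f b) (ha : IsCNOrbit K' k f a) (hf1 : ‖f‖ = 1) {μ : ℝ} (hμ : 0 < μ)
    (hf : gram K' f = μ⁻¹ • f) (hK : ‖K f‖ ^ 2 ≤ μ⁻¹) (n : ℕ) :
    k * ∑ j ∈ Finset.range n, ‖b j - a j‖ ^ 2 ≤
      min (3 / 2 * (‖f - μ • gram K f‖ ^ 2 / μ)) (4 / μ) + 2 * k / (1 + k * μ / 2) := by
  have hK' : ‖K' f‖ ^ 2 = μ⁻¹ := by
    rw [← real_inner_self_eq_norm_sq, ← inner_gram, hf, real_inner_smul_left,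
      real_inner_self_eq_norm_sq, hf1]; ring
  have hpos : 0 ≤ 2 * k / (1 + k * μ / 2) := by positivity
  have hsub : ∀ x y : H, ‖x - y‖ ^ 2 ≤ 2 * (‖x‖ ^ 2 + ‖y‖ ^ 2) := fun x y => by
    nlinarith [parallelogram_sq x y, sq_nonneg ‖x + y‖]
  have hle : ∀ c : ℕ → H, ∑ j ∈ Finset.range n, ‖c j‖ ^ 2 ≤
      ∑ j ∈ Finset.range n, (‖c (j + 1)‖ ^ 2 + ‖c j‖ ^ 2) := fun c =>
    Finset.sum_le_sum fun j _ => by linarith [sq_nonneg ‖c (j + 1)‖]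
  rw [← min_add_add_right]
  refine le_min ?_ ?_
  -- Each value of the error is recovered from a midpoint value and an increment.
  · have h1 := sum_midpoint_error hk hb ha hf1 hμ hf n
    have h2 := hb.sum_increment_le hk hf1 hμ hK n
    have h3 := ha.sum_increment_le hk hf1 hμ hK'.le n
    have h4 : ∑ j ∈ Finset.range n, ‖(b (j + 1) - a (j + 1)) - (b j - a j)‖ ^ 2 ≤
        4 * (1 / (1 + k * μ / 2)) := by
      calc _ ≤ ∑ j ∈ Finset.range n, 2 * (‖b (j + 1) - b j‖ ^ 2 + ‖a (j + 1) - a j‖ ^ 2) := by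
            refine Finset.sum_le_sum fun j _ => ?_
            rw [show (b (j + 1) - a (j + 1)) - (b j - a j)
              = (b (j + 1) - b j) - (a (j + 1) - a j) by abel]
            exact hsub _ _
        _ ≤ _ := by rw [← Finset.mul_sum, Finset.sum_add_distrib]; linarith
    have h5 := hle fun j => b j - a j
    simp_rw [parallelogram_sq] at h5
    rw [Finset.sum_add_distrib, ← Finset.mul_sum, ← Finset.mul_sum] at h5
    have h6 := mul_le_mul_of_nonneg_left h5 hk.le
    have h7 := mul_le_mul_of_nonneg_left h4 hk.le
    rw [show 2 * k / (1 + k * μ / 2) = k * (2 * (1 / (1 + k * μ / 2))) by ring]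
    linarith
  · have h1 := hb.sum_sq_le hk n
    have h2 := ha.sum_sq_le hk n
    have h3 := mul_le_mul_of_nonneg_left (hle b) hk.le
    have h4 := mul_le_mul_of_nonneg_left (hle a) hk.le
    calc k * ∑ j ∈ Finset.range n, ‖b j - a j‖ ^ 2
        ≤ k * ∑ j ∈ Finset.range n, 2 * (‖b j‖ ^ 2 + ‖a j‖ ^ 2) :=
          mul_le_mul_of_nonneg_left (Finset.sum_le_sum fun j _ => hsub _ _) hk.le
      _ ≤ 4 / μ + 2 * k / (1 + k * μ / 2) := by
          rw [← Finset.mul_sum, Finset.sum_add_distrib, div_eq_mul_inv]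
          linarith

end Orbits

/-! ### The primitive operator on `L²(D)` -/

instance : IsProbabilityMeasure volD := ⟨by simp⟩

lemma inner_eq_integral (f g : L2D) : inner ℝ f g = ∫ x in Ioo (0 : ℝ) 1, f x * g x := by
  rw [L2.inner_def]
  refine integral_congr_ae (.of_forall fun x => ?_)
  simp [mul_comm]

lemma norm_sq_eq_integral (f : L2D) : ‖f‖ ^ 2 = ∫ x in Ioo (0 : ℝ) 1, f x ^ 2 := by
  rw [← real_inner_self_eq_norm_sq, inner_eq_integral]
  simp only [sq]

lemma integral_toLp_mul {u : ℝ → ℝ} (hu : MemLp u 2 volD) (g : L2D) :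
    inner ℝ (hu.toLp u) g = ∫ x in Ioo (0 : ℝ) 1, u x * g x := by
  rw [inner_eq_integral]
  refine integral_congr_ae ?_
  filter_upwards [hu.coeFn_toLp] with x hx
  rw [hx]

lemma integral_mul_toLp {u : ℝ → ℝ} (hu : MemLp u 2 volD) (g : L2D) :
    inner ℝ g (hu.toLp u) = ∫ x in Ioo (0 : ℝ) 1, g x * u x := by
  rw [real_inner_comm, integral_toLp_mul]
  simp only [mul_comm]

/-- Cauchy–Schwarz against the constant function `1`. -/
lemma sq_integral_le {α : Type*} [MeasurableSpace α] {μ : Measure α} [IsFiniteMeasure μ]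
    {w : α → ℝ} (hw : MemLp w 2 μ) :
    (∫ x, w x ∂μ) ^ 2 ≤ μ.real univ * ∫ x, w x ^ 2 ∂μ := by
  set m := μ.real univ with hm
  set I := ∫ x, w x ∂μ with hI
  have hw1 : Integrable w μ := hw.integrable (by norm_num)
  have hw2 : Integrable (fun x => w x ^ 2) μ := hw.integrable_sq
  -- The variance of `w` is nonnegative.
  have h1 : ∫ x, (m * w x - I) ^ 2 ∂μ = m * (m * ∫ x, w x ^ 2 ∂μ - I ^ 2) := by
    have : ∀ x, (m * w x - I) ^ 2 = m ^ 2 * w x ^ 2 - 2 * m * I * w x + I ^ 2 := fun x => by ring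
    simp_rw [this]
    have i2 : Integrable (fun x => m ^ 2 * w x ^ 2) μ := hw2.const_mul _
    have i1 : Integrable (fun x => 2 * m * I * w x) μ := hw1.const_mul _
    have i3 : Integrable (fun x => m ^ 2 * w x ^ 2 - 2 * m * I * w x) μ := i2.sub i1
    rw [integral_add i3 (integrable_const _), integral_sub i2 i1, integral_const_mul,
      integral_const_mul, integral_const, ← hI, ← hm, smul_eq_mul]
    ring
  have h2 : 0 ≤ m * (m * ∫ x, w x ^ 2 ∂μ - I ^ 2) := h1 ▸ integral_nonneg fun x => sq_nonneg _
  rcases (measureReal_nonneg (μ := μ) (s := univ)).eq_or_lt with h0 | h0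
  · have hμ : μ = 0 := by
      rwa [eq_comm, measureReal_eq_zero_iff, Measure.measure_univ_eq_zero] at h0
    have : I = 0 := by rw [hI, hμ, integral_zero_measure]
    rw [this, hm, ← h0]; simp
  · have := nonneg_of_mul_nonneg_right h2 (hm ▸ h0)
    linarith

/-- The constant function `1`. -/
def one : L2D := (memLp_const (μ := volD) (p := 2) (1 : ℝ)).toLp _

lemma coeFn_one : (one : ℝ → ℝ) =ᵐ[volD] fun _ => 1 := MemLp.coeFn_toLp _

lemma inner_one_right (f : L2D) : inner ℝ f one = ∫ x in Ioo (0 : ℝ) 1, f x := by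
  rw [one, integral_mul_toLp]; simp

lemma inner_one_one : inner ℝ one one = (1 : ℝ) := by
  rw [one, integral_toLp_mul, ← one]
  rw [integral_congr_ae (g := fun _ => (1 : ℝ))]
  · simp
  · filter_upwards [coeFn_one] with x hx; rw [hx, mul_one]

/-- Extension by zero to the real line. -/
def zeroExt (f : L2D) : ℝ → ℝ := (Ioo (0 : ℝ) 1).indicator f

lemma integrable_zeroExt (f : L2D) : Integrable (zeroExt f) volume :=
  (integrable_indicator_iff measurableSet_Ioo).2 ((Lp.memLp f).integrable (by norm_num))

lemma zeroExt_ae (f : L2D) : zeroExt f =ᵐ[volD] f := indicator_ae_eq_restrict measurableSet_Ioo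

/-- The primitive `x ↦ ∫₀ˣ f`, as a function on the real line. -/
def prim (f : L2D) (x : ℝ) : ℝ := ∫ t in (0 : ℝ)..x, zeroExt f t

lemma continuous_prim (f : L2D) : Continuous (prim f) :=
  intervalIntegral.continuous_primitive (fun _ _ => (integrable_zeroExt f).intervalIntegrable) 0

lemma prim_zero (f : L2D) : prim f 0 = 0 := intervalIntegral.integral_same

lemma prim_sub_prim (f : L2D) (a b : ℝ) : prim f b - prim f a = ∫ t in a..b, zeroExt f t :=
  intervalIntegral.integral_interval_sub_left (integrable_zeroExt f).intervalIntegrable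
    (integrable_zeroExt f).intervalIntegrable

lemma intervalIntegral_zero_one (u : ℝ → ℝ) :
    ∫ x in (0 : ℝ)..1, u x = ∫ x in Ioo (0 : ℝ) 1, u x := by
  rw [intervalIntegral.integral_of_le zero_le_one, integral_Ioc_eq_integral_Ioo]

lemma prim_one (f : L2D) : prim f 1 = inner ℝ f one := by
  rw [inner_one_right, prim, intervalIntegral_zero_one]
  exact integral_congr_ae (zeroExt_ae f)

lemma ae_restrict_of_ae_volD {a b : ℝ} (ha : 0 ≤ a) (hb : b ≤ 1) {p : ℝ → Prop}
    (h : ∀ᵐ x ∂volD, p x) : ∀ᵐ x ∂(volume.restrict (Ioo a b)), p x :=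
  ae_restrict_of_ae_restrict_of_subset (Ioo_subset_Ioo ha hb) h

lemma integral_zeroExt_of_mem (f : L2D) {a b : ℝ} (ha : 0 ≤ a) (hab : a ≤ b) (hb : b ≤ 1) :
    ∫ t in a..b, zeroExt f t = ∫ t in Ioo a b, f t := by
  rw [intervalIntegral.integral_of_le hab, integral_Ioc_eq_integral_Ioo]
  exact integral_congr_ae (ae_restrict_of_ae_volD ha hb (zeroExt_ae f))

lemma abs_prim_le (f : L2D) {x : ℝ} (hx : x ∈ Icc (0 : ℝ) 1) : |prim f x| ≤ ‖f‖ := by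
  rw [prim, integral_zeroExt_of_mem f le_rfl hx.1 hx.2]
  have hsub : Ioo (0 : ℝ) x ⊆ Ioo 0 1 := Ioo_subset_Ioo le_rfl hx.2
  have hm : MemLp f 2 (volume.restrict (Ioo 0 x)) :=
    (Lp.memLp f).mono_measure (Measure.restrict_mono hsub le_rfl)
  have h1 := sq_integral_le hm
  have h2 : ∫ t in Ioo 0 x, f t ^ 2 ≤ ‖f‖ ^ 2 := by
    rw [norm_sq_eq_integral]
    exact setIntegral_mono_set (Lp.memLp f).integrable_sq (.of_forall fun t => sq_nonneg _)
      (.of_forall hsub)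
  have h3 : (volume.restrict (Ioo 0 x)).real univ = x := by simp [hx.1]
  rw [h3] at h1
  refine abs_le_of_sq_le_sq (h1.trans ?_) (norm_nonneg f)
  have h4 : 0 ≤ ∫ t in Ioo 0 x, f t ^ 2 := integral_nonneg fun t => sq_nonneg _
  nlinarith [hx.2]

lemma prim_add (f g : L2D) : prim (f + g) = prim f + prim g := by
  funext x
  rw [Pi.add_apply, prim, prim, prim, ← intervalIntegral.integral_add
    (integrable_zeroExt f).intervalIntegrable (integrable_zeroExt g).intervalIntegrable]
  refine intervalIntegral.integral_congr_ae ?_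
  have h := (ae_restrict_iff' measurableSet_Ioo).1 (Lp.coeFn_add f g)
  filter_upwards [h] with t ht _
  by_cases htm : t ∈ Ioo (0 : ℝ) 1
  · simp only [zeroExt, indicator_of_mem htm, ht htm]; rfl
  · simp [zeroExt, htm]

lemma prim_smul (c : ℝ) (f : L2D) : prim (c • f) = c • prim f := by
  funext x
  rw [Pi.smul_apply, prim, prim, smul_eq_mul, ← intervalIntegral.integral_const_mul]
  refine intervalIntegral.integral_congr_ae ?_
  have h := (ae_restrict_iff' measurableSet_Ioo).1 (Lp.coeFn_smul c f)
  filter_upwards [h] with t ht _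
  by_cases htm : t ∈ Ioo (0 : ℝ) 1
  · simp only [zeroExt, indicator_of_mem htm, ht htm]; rfl
  · simp [zeroExt, htm]

lemma memLp_of_continuous {u : ℝ → ℝ} (hu : Continuous u) : MemLp u 2 volD := by
  obtain ⟨C, hC⟩ := isCompact_Icc.exists_bound_of_continuousOn (hu.continuousOn (s := Icc 0 1))
  refine MemLp.of_bound hu.aestronglyMeasurable C ?_
  filter_upwards [ae_restrict_mem measurableSet_Ioo] with x hx
  exact hC x (Ioo_subset_Icc_self hx)

lemma norm_le_of_ae_abs_le {f : L2D} {c : ℝ} (hc : 0 ≤ c) (h : ∀ᵐ x ∂volD, |f x| ≤ c) :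
    ‖f‖ ≤ c := by
  have := Lp.norm_le_of_ae_bound (f := f) hc (by simpa only [Real.norm_eq_abs] using h)
  simpa [measureUnivNNReal] using this

/-- The primitive operator `f ↦ ∫₀ˣ f` on `L²(D)`. -/
def primL : L2D →L[ℝ] L2D :=
  LinearMap.mkContinuous
    { toFun := fun f => (memLp_of_continuous (continuous_prim f)).toLp (prim f)
      map_add' := fun f g => by
        rw [← MemLp.toLp_add]; congr 1; exact prim_add f g
      map_smul' := fun c f => by
        rw [RingHom.id_apply, ← MemLp.toLp_const_smul]; congr 1; exact prim_smul c f } 1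
    fun f => by
      rw [one_mul]
      refine norm_le_of_ae_abs_le (norm_nonneg f) ?_
      filter_upwards [(memLp_of_continuous (continuous_prim f)).coeFn_toLp,
        ae_restrict_mem measurableSet_Ioo] with x hx hm
      exact hx ▸ abs_prim_le f (Ioo_subset_Icc_self hm)

lemma primL_eq_toLp (f : L2D) : 
    primL f = (memLp_of_continuous (continuous_prim f)).toLp (prim f) := rfl

lemma coeFn_primL (f : L2D) : primL f =ᵐ[volD] prim f :=
  (memLp_of_continuous (continuous_prim f)).coeFn_toLp

lemma norm_primL_le (f : L2D) : ‖primL f‖ ≤ ‖f‖ := by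
  simpa using primL.le_of_opNorm_le (LinearMap.mkContinuous_norm_le _ zero_le_one _) f

/-- Integration by parts: `primL` is skew-adjoint up to the boundary term. -/
lemma inner_primL_add (f g : L2D) :
    inner ℝ (primL f) g + inner ℝ f (primL g) = inner ℝ f one * inner ℝ g one := by
  have hac : ∀ f : L2D, AbsolutelyContinuousOnInterval (prim f) 0 1 := fun f =>
    (integrable_zeroExt f).intervalIntegrable.absolutelyContinuousOnInterval_intervalIntegral
      (by simp)
  -- Lebesgue's differentiation theorem for the absolutely continuous primitive.
  have hd : ∀ f : L2D, ∀ᵐ x ∂volD, deriv (prim f) x = f x := fun f => by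
    have h := (ae_restrict_iff' (μ := volume) measurableSet_Ioo).2
      ((integrable_zeroExt f).intervalIntegrable (a := 0) (b := 1) |>.ae_hasDerivAt_integral.mono
        fun x hx (hm : x ∈ Ioo (0 : ℝ) 1) =>
          hx (by rw [uIcc_of_le zero_le_one]; exact Ioo_subset_Icc_self hm) 0 (by simp))
    filter_upwards [h, zeroExt_ae f] with x hx he
    rw [← he]
    exact hx.deriv
  have h := (hac f).integral_deriv_mul_eq_sub (hac g)
  rw [intervalIntegral_zero_one, prim_zero, zero_mul, sub_zero, prim_one, prim_one] at h
  rw [← h, inner_eq_integral, inner_eq_integral, ← integral_add]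
  · refine integral_congr_ae ?_
    filter_upwards [hd f, hd g, coeFn_primL f, coeFn_primL g] with x h1 h2 h3 h4
    rw [h1, h2, h3, h4]; ring
  · exact (Lp.memLp (primL f)).integrable_mul (Lp.memLp g)
  · exact (Lp.memLp f).integrable_mul (Lp.memLp (primL g))

/-- The orthogonal projection onto the functions of mean zero. -/
def Q0 : L2D →L[ℝ] L2D :=
  ContinuousLinearMap.id ℝ L2D - (innerSL ℝ one).smulRight one

lemma Q0_apply (f : L2D) : Q0 f = f - (inner ℝ f one : ℝ) • one := by
  simp [Q0, real_inner_comm]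

lemma inner_Q0_one (f : L2D) : inner ℝ (Q0 f) one = (0 : ℝ) := by
  rw [Q0_apply, inner_sub_left, real_inner_smul_left, inner_one_one]; ring

lemma norm_Q0_le (f : L2D) : ‖Q0 f‖ ≤ ‖f‖ := by
  have h : ‖Q0 f‖ ^ 2 ≤ ‖f‖ * ‖Q0 f‖ := by
    rw [← real_inner_self_eq_norm_sq]
    have : inner ℝ (Q0 f) (Q0 f) = inner ℝ f (Q0 f) := by
      have h1 : inner ℝ one (Q0 f) = (0 : ℝ) := by rw [real_inner_comm, inner_Q0_one]
      nth_rw 1 [Q0_apply f]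
      rw [inner_sub_left, real_inner_smul_left, h1, mul_zero, sub_zero]
    rw [this]
    exact real_inner_le_norm _ _
  by_contra! hcon
  nlinarith [norm_nonneg f]

/-- The solution operator of the boundary value problem `u'' = f` in `D`, `u(0) = u(1) = 0`. -/
def G : L2D →L[ℝ] L2D := primL.comp (Q0.comp primL)

lemma G_apply (f : L2D) : G f = primL (Q0 (primL f)) := rfl

lemma inner_primL_of_mean_zero {f : L2D} (hf : inner ℝ f one = (0 : ℝ)) (g : L2D) :
    inner ℝ (primL f) g = -inner ℝ f (primL g) := by
  have := inner_primL_add f g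
  rw [hf, zero_mul] at this
  linarith

lemma inner_G (f g : L2D) : inner ℝ (G f) g = -inner ℝ (Q0 (primL f)) (Q0 (primL g)) := by
  rw [G_apply, inner_primL_of_mean_zero (inner_Q0_one _)]
  congr 1
  conv_rhs => rw [Q0_apply (primL g), inner_sub_right, real_inner_smul_right, inner_Q0_one,
    mul_zero, sub_zero]

lemma G_symm (f g : L2D) : inner ℝ (G f) g = inner ℝ f (G g) := by
  rw [inner_G, ← real_inner_comm f, inner_G, real_inner_comm]

/-! ### Weak derivatives -/

/-- The test functions on `D`. -/
structure IsTest (φ : ℝ → ℝ) : Prop where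
  contDiff : ContDiff ℝ (⊤ : ℕ∞) φ
  hasCompactSupport : HasCompactSupport φ
  tsupport_subset : tsupport φ ⊆ Ioo (0 : ℝ) 1

lemma IsTest.continuous {φ : ℝ → ℝ} (h : IsTest φ) : Continuous φ := h.contDiff.continuous

protected lemma IsTest.deriv {φ : ℝ → ℝ} (h : IsTest φ) : IsTest (deriv φ) :=
  ⟨(contDiff_infty_iff_deriv.1 h.contDiff).2, h.hasCompactSupport.deriv,
    tsupport_deriv_subset.trans h.tsupport_subset⟩

lemma IsTest.eq_zero {φ : ℝ → ℝ} (h : IsTest φ) {x : ℝ} (hx : x ∉ Ioo (0 : ℝ) 1) : φ x = 0 :=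
  image_eq_zero_of_notMem_tsupport fun hx' => hx (h.tsupport_subset hx')

lemma isWeakDeriv_iff {k : ℕ} {g z : L2D} : IsWeakDeriv k g z ↔ ∀ φ, IsTest φ →
    ∫ x in Ioo (0 : ℝ) 1, g x * iteratedDeriv k φ x =
      (-1) ^ k * ∫ x in Ioo (0 : ℝ) 1, z x * φ x :=
  ⟨fun h φ hφ => h φ hφ.1 hφ.2 hφ.3, fun h φ h1 h2 h3 => h φ ⟨h1, h2, h3⟩⟩

lemma isWeakDeriv_zero (g : L2D) : IsWeakDeriv 0 g g :=
  isWeakDeriv_iff.2 fun φ _ => by simp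

lemma isWeakDeriv_one_iff {g z : L2D} : IsWeakDeriv 1 g z ↔ ∀ φ, IsTest φ →
    ∫ x in Ioo (0 : ℝ) 1, g x * deriv φ x = - ∫ x in Ioo (0 : ℝ) 1, z x * φ x := by
  rw [isWeakDeriv_iff]; simp [iteratedDeriv_one]

lemma IsWeakDeriv.succ {k : ℕ} {g z w : L2D} (h : IsWeakDeriv k g z) (h1 : IsWeakDeriv 1 z w) :
    IsWeakDeriv (k + 1) g w := by
  rw [isWeakDeriv_iff] at h ⊢
  rw [isWeakDeriv_one_iff] at h1
  intro φ hφ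
  rw [iteratedDeriv_succ', h _ hφ.deriv, h1 φ hφ, pow_succ]
  ring

/-- The second weak derivative is the weak derivative of the first one. -/
lemma IsWeakDeriv.of_one_of_two {g z w : L2D} (h1 : IsWeakDeriv 1 g z) (h2 : IsWeakDeriv 2 g w) :
    IsWeakDeriv 1 z w := by
  rw [isWeakDeriv_one_iff] at h1 ⊢
  rw [isWeakDeriv_iff] at h2
  intro φ hφ
  have e1 := h1 _ hφ.deriv
  have e2 := h2 φ hφ
  rw [iteratedDeriv_succ', iteratedDeriv_one, e1] at e2
  linarith

/-- The fundamental lemma of the calculus of variations on `D`. -/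
lemma eq_zero_of_forall_test {h : L2D}
    (H : ∀ φ, IsTest φ → ∫ x in Ioo (0 : ℝ) 1, h x * φ x = 0) : h = 0 := by
  rw [Lp.eq_zero_iff_ae_eq_zero]
  have hint : IntegrableOn h (Ioo 0 1) volume := (Lp.memLp h).integrable (by norm_num)
  have := isOpen_Ioo.ae_eq_zero_of_integral_contDiff_smul_eq_zero hint.locallyIntegrableOn
    (fun g hg hgc hgs => ?_)
  · exact (ae_restrict_iff' measurableSet_Ioo).2 this
  · have ht : IsTest g := ⟨hg, hgc, hgs⟩
    rw [← H g ht, ← setIntegral_eq_integral_of_forall_compl_eq_zero (s := Ioo (0 : ℝ) 1)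
      fun x hx => by rw [ht.eq_zero hx, zero_smul]]
    simp [mul_comm]

lemma integrable_mul_of_continuous (f : L2D) {u : ℝ → ℝ} (hu : Continuous u) :
    Integrable (fun x => f x * u x) volD :=
  (Lp.memLp f).integrable_mul (memLp_of_continuous hu)

lemma integral_sub_mul (f g : L2D) {u : ℝ → ℝ} (hu : Continuous u) :
    ∫ x in Ioo (0 : ℝ) 1, (f - g) x * u x =
      (∫ x in Ioo (0 : ℝ) 1, f x * u x) - ∫ x in Ioo (0 : ℝ) 1, g x * u x := by
  simp_rw [← integral_mul_toLp (memLp_of_continuous hu), inner_sub_left]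

lemma IsWeakDeriv.unique {k : ℕ} {g z z' : L2D} (h : IsWeakDeriv k g z)
    (h' : IsWeakDeriv k g z') : z = z' := by
  rw [isWeakDeriv_iff] at h h'
  rw [← sub_eq_zero]
  refine eq_zero_of_forall_test fun φ hφ => ?_
  have e := (h φ hφ).symm.trans (h' φ hφ)
  rw [integral_sub_mul _ _ hφ.continuous, sub_eq_zero]
  exact mul_left_cancel₀ (pow_ne_zero k (by norm_num)) e

lemma IsWeakDeriv.weakDeriv_eq {k : ℕ} {g z : L2D} (h : IsWeakDeriv k g z) :
    weakDeriv k g = z := by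
  have hex : ∃ z, IsWeakDeriv k g z := ⟨z, h⟩
  rw [weakDeriv, dif_pos hex]
  exact hex.choose_spec.unique h

lemma primL_toLp_of_hasDerivAt {F F' : ℝ → ℝ} (hF : ∀ x, HasDerivAt F (F' x) x)
    (hc : Continuous F) (hc' : Continuous F') :
    primL ((memLp_of_continuous hc').toLp F') = (memLp_of_continuous hc).toLp F - F 0 • one := by
  rw [primL_eq_toLp, one, ← MemLp.toLp_const_smul, ← MemLp.toLp_sub, MemLp.toLp_eq_toLp_iff]
  filter_upwards [ae_restrict_mem measurableSet_Ioo] with x hx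
  rw [prim, integral_zeroExt_of_mem _ le_rfl hx.1.le hx.2.le]
  have h1 : ∫ t in Ioo 0 x, ((memLp_of_continuous hc').toLp F') t = ∫ t in Ioo 0 x, F' t :=
    integral_congr_ae (ae_restrict_of_ae_volD le_rfl hx.2.le
      (memLp_of_continuous hc').coeFn_toLp)
  rw [h1, ← integral_Ioc_eq_integral_Ioo, ← intervalIntegral.integral_of_le hx.1.le,
    intervalIntegral.integral_eq_sub_of_hasDerivAt (fun y _ => hF y)
      (hc'.intervalIntegrable _ _)]
  simp

/-- The primitive of the derivative of a test function is that test function. -/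
lemma IsTest.primL_deriv {φ : ℝ → ℝ} (h : IsTest φ) :
    primL ((memLp_of_continuous h.deriv.continuous).toLp (deriv φ)) =
      (memLp_of_continuous h.continuous).toLp φ := by
  rw [primL_toLp_of_hasDerivAt
    (fun x => ((h.contDiff.differentiable (by simp)).differentiableAt).hasDerivAt)
    h.continuous h.deriv.continuous, h.eq_zero (x := 0) (by simp), zero_smul, sub_zero]

lemma IsTest.integral_deriv {φ : ℝ → ℝ} (h : IsTest φ) :
    ∫ x in Ioo (0 : ℝ) 1, deriv φ x = 0 := by
  rw [← intervalIntegral_zero_one, intervalIntegral.integral_deriv_eq_sub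
      (fun y _ => (h.contDiff.differentiable (by simp)).differentiableAt)
      (h.deriv.continuous.intervalIntegrable _ _), h.eq_zero (x := 0) (by simp),
      h.eq_zero (x := 1) (by simp), sub_zero]

/-- A primitive has the expected weak derivative. -/
lemma isWeakDeriv_primL_add (z : L2D) (c : ℝ) : IsWeakDeriv 1 (primL z + c • one) z := by
  rw [isWeakDeriv_one_iff]
  intro φ hφ
  set d : L2D := (memLp_of_continuous hφ.deriv.continuous).toLp (deriv φ) with hd
  have h1 : inner ℝ d one = (0 : ℝ) := by
    rw [inner_one_right]
    exact (integral_congr_ae (memLp_of_continuous hφ.deriv.continuous).coeFn_toLp).trans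
      hφ.integral_deriv
  have h2 := inner_primL_add z d
  rw [h1, mul_zero, hd, hφ.primL_deriv, ← hd, integral_mul_toLp (memLp_of_continuous hφ.continuous)]
    at h2
  rw [← integral_mul_toLp (memLp_of_continuous hφ.deriv.continuous), ← hd, inner_add_left,
    real_inner_smul_left, real_inner_comm d one, h1]
  linarith

lemma isWeakDeriv_primL (z : L2D) : IsWeakDeriv 1 (primL z) z := by
  simpa using isWeakDeriv_primL_add z 0

lemma isWeakDeriv_primL_Q0 (z : L2D) : IsWeakDeriv 1 (Q0 (primL z)) z := by
  rw [Q0_apply, sub_eq_add_neg, ← neg_smul]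
  exact isWeakDeriv_primL_add z _

lemma isWeakDeriv_G (z : L2D) : IsWeakDeriv 2 (G z) z :=
  (isWeakDeriv_primL _).succ (isWeakDeriv_primL_Q0 z)

/-- A test function of mean zero is the derivative of a test function. -/
lemma IsTest.exists_primitive {v : ℝ → ℝ} (h : IsTest v) (h0 : ∫ x in Ioo (0 : ℝ) 1, v x = 0) :
    ∃ φ, IsTest φ ∧ deriv φ = v := by
  rcases (tsupport v).eq_empty_or_nonempty with he | hne
  · rw [tsupport_eq_empty_iff] at he
    exact ⟨v, h, by rw [he]; exact deriv_const' 0⟩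
  have hcomp : IsCompact (tsupport v) := h.hasCompactSupport
  obtain ⟨a, haK, ha⟩ := hcomp.exists_isLeast hne
  obtain ⟨b, hbK, hb⟩ := hcomp.exists_isGreatest hne
  have ha0 := h.tsupport_subset haK
  have hb0 := h.tsupport_subset hbK
  have hva : ∀ x < a, v x = 0 := fun x hx =>
    image_eq_zero_of_notMem_tsupport fun hx' => absurd (ha hx') (not_le.2 hx)
  have hvb : ∀ x > b, v x = 0 := fun x hx =>
    image_eq_zero_of_notMem_tsupport fun hx' => absurd (hb hx') (not_le.2 hx)
  let φ : ℝ → ℝ := fun x => ∫ t in (0 : ℝ)..x, v t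
  have hd : ∀ x, HasDerivAt φ (v x) x := fun x =>
    intervalIntegral.integral_hasDerivAt_right (h.continuous.intervalIntegrable _ _)
      (h.continuous.stronglyMeasurableAtFilter _ _) h.continuous.continuousAt
  have hdv : deriv φ = v := funext fun x => (hd x).deriv
  have hsupp : Function.support φ ⊆ Icc a b := by
    intro x hx
    by_contra hcon
    apply hx
    simp only [mem_Icc, not_and_or, not_le] at hcon
    have hii : ∀ c d : ℝ, IntervalIntegrable v volume c d := fun c d =>
      h.continuous.intervalIntegrable _ _
    rcases hcon with hxa | hxb
    · refine intervalIntegral.integral_zero_ae (.of_forall fun t ht => hva t ?_)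
      have := ht.2
      exact this.trans_lt (max_lt ha0.1 hxa)
    · have h1 : φ x = (∫ t in (0 : ℝ)..1, v t) + ∫ t in (1 : ℝ)..x, v t :=
        (intervalIntegral.integral_add_adjacent_intervals (hii _ _) (hii _ _)).symm
      rw [h1, intervalIntegral_zero_one, h0, zero_add]
      refine intervalIntegral.integral_zero_ae (.of_forall fun t ht => hvb t ?_)
      exact (lt_min hb0.2 hxb).trans ht.1
  -- The mean of `v` vanishes, so that the support of `φ` stays within the hull of that of `v`.
  have hts : tsupport φ ⊆ Icc a b := closure_minimal hsupp isClosed_Icc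
  refine ⟨φ, ⟨?_, isCompact_Icc.of_isClosed_subset (isClosed_tsupport _) hts,
    hts.trans fun x hx => ⟨ha0.1.trans_le hx.1, hx.2.trans_lt hb0.2⟩⟩, hdv⟩
  rw [contDiff_infty_iff_deriv, hdv]
  exact ⟨fun x => (hd x).differentiableAt, h.contDiff⟩

lemma exists_test_integral_one : ∃ ψ, IsTest ψ ∧ ∫ x in Ioo (0 : ℝ) 1, ψ x = 1 := by
  let B : ContDiffBump (1 / 2 : ℝ) := ⟨1 / 8, 1 / 4, by norm_num, by norm_num⟩
  have hB : IsTest (B.normed volume) := by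
    refine ⟨B.contDiff_normed, B.hasCompactSupport_normed, ?_⟩
    rw [B.tsupport_normed_eq, Real.closedBall_eq_Icc]
    intro x hx
    simp only [B, mem_Icc] at hx
    constructor <;> linarith [hx.1, hx.2]
  refine ⟨_, hB, ?_⟩
  rw [setIntegral_eq_integral_of_forall_compl_eq_zero fun x hx => hB.eq_zero hx]
  exact B.integral_normed

/-- The lemma of du Bois-Reymond: a function with weak derivative `0` is constant. -/
lemma eq_const_of_isWeakDeriv_zero {d : L2D} (h : IsWeakDeriv 1 d 0) : ∃ c : ℝ, d = c • one := by
  obtain ⟨ψ, hψ, hψ1⟩ := exists_test_integral_one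
  set c := ∫ x in Ioo (0 : ℝ) 1, d x * ψ x with hc
  refine ⟨c, ?_⟩
  rw [← sub_eq_zero]
  refine eq_zero_of_forall_test fun w hw => ?_
  set I := ∫ x in Ioo (0 : ℝ) 1, w x with hI
  have hwi : Integrable w volD := (memLp_of_continuous hw.continuous).integrable (by norm_num)
  have hψi : Integrable ψ volD := (memLp_of_continuous hψ.continuous).integrable (by norm_num)
  -- Subtracting a multiple of `ψ` makes the mean of `w` vanish.
  have hv : IsTest (fun x => w x - I * ψ x) := by
    refine ⟨hw.contDiff.sub (contDiff_const.mul hψ.contDiff), ?_, ?_⟩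
    · exact hw.hasCompactSupport.sub hψ.hasCompactSupport.mul_left
    · refine (tsupport_sub _ _).trans (union_subset hw.tsupport_subset ?_)
      exact (tsupport_mul_subset_right (f := fun _ => I)).trans hψ.tsupport_subset
  obtain ⟨φ, hφ, hφv⟩ := hv.exists_primitive (by
    rw [integral_sub hwi (hψi.const_mul _), integral_const_mul, hψ1, ← hI]; ring)
  have h1 := isWeakDeriv_one_iff.1 h φ hφ
  have h2 : ∫ x in Ioo (0 : ℝ) 1, (0 : L2D) x * φ x = 0 := by
    rw [← integral_mul_toLp (memLp_of_continuous hφ.continuous), inner_zero_left]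
  rw [h2, neg_zero, hφv] at h1
  have h3 : ∫ x in Ioo (0 : ℝ) 1, d x * (w x - I * ψ x) =
      (∫ x in Ioo (0 : ℝ) 1, d x * w x) - I * c := by
    have e : ∀ x, d x * (w x - I * ψ x) = d x * w x - I * (d x * ψ x) := fun x => by ring
    simp_rw [e]
    rw [integral_sub (integrable_mul_of_continuous d hw.continuous)
      ((integrable_mul_of_continuous d hψ.continuous).const_mul _), integral_const_mul]
  rw [h3] at h1
  have h4 : ∫ x in Ioo (0 : ℝ) 1, (c • one : L2D) x * w x = c * I := by
    rw [← integral_mul_toLp (memLp_of_continuous hw.continuous), real_inner_smul_left,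
      real_inner_comm, inner_one_right, hI]
    congr 1
    exact integral_congr_ae (MemLp.coeFn_toLp _)
  rw [integral_sub_mul _ _ hw.continuous, h4]
  linarith

lemma integral_zero_mul (u : ℝ → ℝ) : ∫ x in Ioo (0 : ℝ) 1, (0 : L2D) x * u x = 0 := by
  rw [integral_congr_ae (g := fun _ => (0 : ℝ)), integral_zero]
  filter_upwards [Lp.coeFn_zero ℝ 2 volD] with x hx
  rw [hx]; simp

lemma IsWeakDeriv.exists_eq_primL_add {g z : L2D} (h : IsWeakDeriv 1 g z) :
    ∃ c : ℝ, g = primL z + c • one := by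
  have h1 : IsWeakDeriv 1 (g - primL z) 0 := by
    have h2 := isWeakDeriv_primL z
    rw [isWeakDeriv_one_iff] at h h2 ⊢
    intro φ hφ
    rw [integral_sub_mul _ _ hφ.deriv.continuous, h φ hφ, h2 φ hφ, integral_zero_mul]
    ring
  obtain ⟨c, hc⟩ := eq_const_of_isWeakDeriv_zero h1
  exact ⟨c, by rw [← hc]; abel⟩

lemma eqOn_Icc_of_ae_eq {f g : ℝ → ℝ} (hf : ContinuousOn f (Icc 0 1))
    (hg : ContinuousOn g (Icc 0 1)) (h : f =ᵐ[volD] g) : EqOn f g (Icc 0 1) := by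
  have h1 : EqOn f g (Ioo 0 1) := Measure.eqOn_open_of_ae_eq h isOpen_Ioo
    (hf.mono Ioo_subset_Icc_self) (hg.mono Ioo_subset_Icc_self)
  exact h1.of_subset_closure hf hg Ioo_subset_Icc_self
    (by rw [closure_Ioo (by norm_num)])

/-- The boundary value problem `u'' = f`, `u(0) = u(1) = 0` has a unique solution: a function in
`H²(D) ∩ H¹₀(D)` is recovered from its second weak derivative. -/
lemma eq_G_weakDeriv {χ : L2D} (h2 : MemH 2 χ) (h1 : MemH10 χ) : χ = G (weakDeriv 2 χ) := by
  obtain ⟨z1, hz1⟩ := h2 1 (by norm_num)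
  obtain ⟨z2, hz2⟩ := h2 2 le_rfl
  rw [hz2.weakDeriv_eq]
  obtain ⟨c, hc⟩ := (hz1.of_one_of_two hz2).exists_eq_primL_add
  obtain ⟨d, hd⟩ := hz1.exists_eq_primL_add
  obtain ⟨-, f, hf, hfχ, hf0, hf1⟩ := h1
  have hcont : Continuous fun x => prim z1 x + d := (continuous_prim z1).add continuous_const
  have he : EqOn f (fun x => prim z1 x + d) (Icc 0 1) := by
    refine eqOn_Icc_of_ae_eq hf hcont.continuousOn ?_
    filter_upwards [hfχ, coeFn_primL z1, Lp.coeFn_add (primL z1) (d • one), Lp.coeFn_smul d one,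
      coeFn_one] with x e1 e2 e3 e4 e5
    rw [← e1, hd, e3, Pi.add_apply, e2, e4, Pi.smul_apply, e5, smul_eq_mul, mul_one]
  have hd0 : d = 0 := by
    have := he (x := 0) (by simp)
    simpa [hf0, prim_zero] using this.symm
  have hm : inner ℝ z1 one = (0 : ℝ) := by
    have := he (x := 1) (by simp)
    simpa [hf1, prim_one, hd0] using this.symm
  have hz : z1 = Q0 (primL z2) := by
    have hQ : Q0 z1 = Q0 (primL z2) := by
      rw [hc, map_add, map_smul]
      have : Q0 one = 0 := by rw [Q0_apply, inner_one_one, one_smul, sub_self]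
      rw [this, smul_zero, add_zero]
    rw [← hQ, Q0_apply, hm, zero_smul, sub_zero]
  rw [hd, hd0, zero_smul, add_zero, G_apply, ← hz]

lemma memH10_G (y : L2D) : MemH10 (G y) := by
  refine ⟨fun l hl => ?_, prim (Q0 (primL y)), (continuous_prim _).continuousOn, coeFn_primL _,
    prim_zero _, ?_⟩
  · interval_cases l
    · exact ⟨_, isWeakDeriv_zero _⟩
    · exact ⟨_, isWeakDeriv_primL _⟩
  · rw [prim_one, inner_Q0_one]

lemma memH_two_G (y : L2D) : MemH 2 (G y) := fun l hl => by
  interval_cases l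
  · exact ⟨_, isWeakDeriv_zero _⟩
  · exact ⟨_, isWeakDeriv_primL _⟩
  · exact ⟨_, isWeakDeriv_G y⟩

/-! ### The sine system -/

lemma continuous_eps (k : ℕ) : Continuous (eps k) := by unfold eps; fun_prop

/-- The eigenfunction `eps k` as an element of `L²(D)`. -/
def sinL (k : ℕ) : L2D := (memLp_of_continuous (continuous_eps k)).toLp (eps k)

lemma continuous_cos_lam (k : ℕ) : Continuous fun x => Real.sqrt 2 * Real.cos (lam k * x) := by
  fun_prop

/-- The function `x ↦ √2 cos (lam k * x)` as an element of `L²(D)`. -/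
def cosL (k : ℕ) : L2D :=
  (memLp_of_continuous (continuous_cos_lam k)).toLp fun x => Real.sqrt 2 * Real.cos (lam k * x)

lemma coeFn_sinL (k : ℕ) : sinL k =ᵐ[volD] eps k :=
  (memLp_of_continuous (continuous_eps k)).coeFn_toLp

lemma lam_pos {k : ℕ} (hk : 0 < k) : 0 < lam k := by unfold lam; positivity

lemma lam_injective : Function.Injective lam := fun j k h => by
  unfold lam at h
  exact_mod_cast mul_right_cancel₀ Real.pi_ne_zero h

lemma hasDerivAt_eps (k : ℕ) (x : ℝ) :
    HasDerivAt (eps k) (lam k * (Real.sqrt 2 * Real.cos (lam k * x))) x := by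
  have h : HasDerivAt (fun x => lam k * x) (lam k) x := by
    simpa using (hasDerivAt_id x).const_mul (lam k)
  convert! (h.sin).const_mul (Real.sqrt 2) using 1
  ring

lemma hasDerivAt_cos_lam (k : ℕ) (x : ℝ) :
    HasDerivAt (fun x => Real.sqrt 2 * Real.cos (lam k * x)) (-lam k * eps k x) x := by
  have h : HasDerivAt (fun x => lam k * x) (lam k) x := by
    simpa using (hasDerivAt_id x).const_mul (lam k)
  convert! (h.cos).const_mul (Real.sqrt 2) using 1
  unfold eps; ring

lemma lam_smul_primL_cosL (k : ℕ) : lam k • primL (cosL k) = sinL k := by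
  have h := primL_toLp_of_hasDerivAt (hasDerivAt_eps k) (continuous_eps k)
    (continuous_const.mul (continuous_cos_lam k))
  have h0 : eps k 0 = 0 := by simp [eps]
  rw [h0, zero_smul, sub_zero] at h
  rw [sinL, ← h, ← map_smul, cosL, ← MemLp.toLp_const_smul]
  rfl

lemma lam_smul_primL_sinL (k : ℕ) : lam k • primL (sinL k) = -cosL k + Real.sqrt 2 • one := by
  have h := primL_toLp_of_hasDerivAt (hasDerivAt_cos_lam k) (continuous_cos_lam k)
    (continuous_const.mul (continuous_eps k))
  simp only [mul_zero, Real.cos_zero, mul_one] at h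
  rw [← neg_inj, ← neg_smul, neg_add, neg_neg, ← sub_eq_add_neg, cosL, ← h, ← map_smul, sinL,
    ← MemLp.toLp_const_smul]
  rfl

lemma inner_cosL_one {k : ℕ} (hk : 0 < k) : inner ℝ (cosL k) one = (0 : ℝ) := by
  have h : lam k * inner ℝ (cosL k) one = eps k 1 - eps k 0 := by
    rw [inner_one_right, ← integral_const_mul, ← intervalIntegral_zero_one,
      ← intervalIntegral.integral_eq_sub_of_hasDerivAt (fun y _ => hasDerivAt_eps k y)
      ((continuous_const.mul (continuous_cos_lam k)).intervalIntegrable _ _),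
      intervalIntegral_zero_one, intervalIntegral_zero_one]
    refine integral_congr_ae ?_
    filter_upwards [(memLp_of_continuous (continuous_cos_lam k)).coeFn_toLp] with x hx
    rw [cosL, hx]
  have h1 : eps k 1 - eps k 0 = 0 := by simp [eps, lam]
  rw [h1] at h
  exact (mul_eq_zero.1 h).resolve_left (lam_pos hk).ne'

lemma lam_smul_Q0_primL_sinL {k : ℕ} (hk : 0 < k) : lam k • Q0 (primL (sinL k)) = -cosL k := by
  have hone : Q0 one = 0 := by rw [Q0_apply, inner_one_one, one_smul, sub_self]
  rw [← map_smul, lam_smul_primL_sinL, map_add, map_smul, hone, smul_zero, add_zero, map_neg,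
    Q0_apply, inner_cosL_one hk, zero_smul, sub_zero]

lemma G_sinL {k : ℕ} (hk : 0 < k) : G (sinL k) = -(lam k ^ 2)⁻¹ • sinL k := by
  have hl := (lam_pos hk).ne'
  have h1 : Q0 (primL (sinL k)) = -((lam k)⁻¹ • cosL k) := by
    rw [← smul_neg, ← lam_smul_Q0_primL_sinL hk, smul_smul, inv_mul_cancel₀ hl, one_smul]
  have h2 : primL (cosL k) = (lam k)⁻¹ • sinL k := by
    rw [← lam_smul_primL_cosL k, smul_smul, inv_mul_cancel₀ hl, one_smul]
  rw [G_apply, h1, map_neg, map_smul, h2, smul_smul, neg_smul, sq, mul_inv]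

lemma norm_sinL {k : ℕ} (hk : 0 < k) : ‖sinL k‖ = 1 := by
  have hl := (lam_pos hk).ne'
  have h1 : ‖sinL k‖ ^ 2 = ‖cosL k‖ ^ 2 := by
    have h := inner_primL_of_mean_zero (inner_cosL_one hk) (sinL k)
    have h' : lam k * inner ℝ (primL (cosL k)) (sinL k)
        = -inner ℝ (cosL k) (lam k • primL (sinL k)) := by
      rw [h, real_inner_smul_right]; ring
    rw [← real_inner_smul_left, lam_smul_primL_cosL, lam_smul_primL_sinL, inner_add_right,
      inner_neg_right, real_inner_smul_right, inner_cosL_one hk, real_inner_self_eq_norm_sq,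
      real_inner_self_eq_norm_sq] at h'
    linarith
  -- By `sin² + cos² = 1`; the two norms agree by integration by parts.
  have h2 : ‖sinL k‖ ^ 2 + ‖cosL k‖ ^ 2 = 2 := by
    rw [norm_sq_eq_integral, norm_sq_eq_integral, ← integral_add (Lp.memLp _).integrable_sq
      (Lp.memLp _).integrable_sq, integral_congr_ae (g := fun _ => (2 : ℝ))]
    · simp
    · filter_upwards [coeFn_sinL k,
        (memLp_of_continuous (continuous_cos_lam k)).coeFn_toLp] with x e1 e2
      rw [e1, cosL, e2, eps, mul_pow, mul_pow, ← mul_add, Real.sin_sq_add_cos_sq,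
        Real.sq_sqrt (by norm_num), mul_one]
  have h3 : ‖sinL k‖ ^ 2 = 1 := by linarith
  nlinarith [norm_nonneg (sinL k)]

lemma inner_sinL_of_ne {j k : ℕ} (hj : 0 < j) (hk : 0 < k) (hjk : j ≠ k) :
    inner ℝ (sinL j) (sinL k) = (0 : ℝ) := by
  have h := G_symm (sinL j) (sinL k)
  rw [G_sinL hj, G_sinL hk, real_inner_smul_left, real_inner_smul_right] at h
  have h1 : (lam j ^ 2)⁻¹ ≠ (lam k ^ 2)⁻¹ := by
    intro h2
    have h3 := inv_injective h2
    rw [pow_left_inj₀ (lam_pos hj).le (lam_pos hk).le (by norm_num)] at h3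
    exact hjk (lam_injective h3)
  by_contra hne
  have := mul_right_cancel₀ hne h
  exact h1 (neg_injective this)

lemma inner_sinL (f : L2D) (k : ℕ) :
    inner ℝ f (sinL k) = ∫ x in Ioo (0 : ℝ) 1, f x * eps k x :=
  integral_mul_toLp _ _

lemma norm_Q0_primL_sinL {k : ℕ} (hk : 0 < k) : ‖Q0 (primL (sinL k))‖ = (lam k)⁻¹ := by
  have hl := lam_pos hk
  have h := inner_G (sinL k) (sinL k)
  rw [G_sinL hk, real_inner_smul_left, real_inner_self_eq_norm_sq, real_inner_self_eq_norm_sq,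
    norm_sinL hk] at h
  have h1 : ‖Q0 (primL (sinL k))‖ ^ 2 = ((lam k)⁻¹) ^ 2 := by rw [inv_pow]; linarith
  exact (pow_left_inj₀ (norm_nonneg _) (inv_pos.2 hl).le (by norm_num)).1 h1

lemma integral_mul_sin_mul_cos_pow {f : L2D}
    (hf : ∀ k : ℕ, 0 < k → inner ℝ f (sinL k) = (0 : ℝ)) (n : ℕ) : ∀ k : ℕ,
    ∫ x in Ioo (0 : ℝ) 1, f x * (Real.sin (k * Real.pi * x) * Real.cos (Real.pi * x) ^ n) = 0 := by
  induction n with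
  | zero =>
    intro k
    rcases Nat.eq_zero_or_pos k with rfl | hk
    · simp
    · have h := hf k hk
      rw [inner_sinL] at h
      have e : ∀ x, f x * eps k x = Real.sqrt 2 *
          (f x * (Real.sin (k * Real.pi * x) * Real.cos (Real.pi * x) ^ 0)) := fun x => by
        simp only [eps, lam]; ring
      simp_rw [e, integral_const_mul] at h
      exact (mul_eq_zero.1 h).resolve_left (by positivity)
  | succ n ih =>
    intro k
    rcases Nat.eq_zero_or_pos k with rfl | hk
    · simp
    · have e : ∀ x, f x * (Real.sin (k * Real.pi * x) * Real.cos (Real.pi * x) ^ (n + 1)) =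
          1 / 2 * (f x * (Real.sin (((k + 1 : ℕ) : ℝ) * Real.pi * x) *
            Real.cos (Real.pi * x) ^ n)) +
          1 / 2 * (f x * (Real.sin (((k - 1 : ℕ) : ℝ) * Real.pi * x) *
            Real.cos (Real.pi * x) ^ n)) := fun x => by
        rw [Nat.cast_sub hk, Nat.cast_add, Nat.cast_one,
          show ((k : ℝ) + 1) * Real.pi * x = k * Real.pi * x + Real.pi * x by ring,
          show ((k : ℝ) - 1) * Real.pi * x = k * Real.pi * x - Real.pi * x by ring,
          Real.sin_add, Real.sin_sub]
        ring
      simp_rw [e]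
      rw [integral_add, integral_const_mul, integral_const_mul, ih, ih]
      · simp
      all_goals
        refine (integrable_mul_of_continuous f ?_).const_mul _
        fun_prop

/-- The sine system is complete. The span of the sines contains `sin (π x) q (cos (π x))` for each
polynomial `q`, and these functions approximate `sin (π x) φ(x)` for each test function `φ`. -/
lemma eq_zero_of_forall_inner_sinL {f : L2D}
    (hf : ∀ k : ℕ, 0 < k → inner ℝ f (sinL k) = (0 : ℝ)) : f = 0 := by
  have hcs : Continuous fun x => Real.sin (Real.pi * x) := by fun_prop
  have hpoly : ∀ q : Polynomial ℝ, ∫ x in Ioo (0 : ℝ) 1,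
      f x * (Real.sin (Real.pi * x) * q.eval (Real.cos (Real.pi * x))) = 0 := by
    intro q
    have hcont : ∀ q : Polynomial ℝ, Continuous
        fun x => Real.sin (Real.pi * x) * q.eval (Real.cos (Real.pi * x)) := fun q =>
      hcs.mul (q.continuous.comp (by fun_prop))
    induction q using Polynomial.induction_on' with
    | add p q hp hq =>
      simp_rw [Polynomial.eval_add, mul_add]
      rw [integral_add, hp, hq, add_zero]
      · exact integrable_mul_of_continuous f (hcont p)
      · exact integrable_mul_of_continuous f (hcont q)
    | monomial n a =>
      have h := integral_mul_sin_mul_cos_pow hf n 1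
      have e : ∀ x, f x * (Real.sin (Real.pi * x) *
          (Polynomial.monomial n a).eval (Real.cos (Real.pi * x))) =
          a * (f x * (Real.sin ((1 : ℕ) * Real.pi * x) * Real.cos (Real.pi * x) ^ n)) := fun x => by
        rw [Polynomial.eval_monomial, Nat.cast_one, one_mul]; ring
      simp_rw [e, integral_const_mul, h, mul_zero]
  have hfi : Integrable (fun x => |f x|) volD := ((Lp.memLp f).integrable (by norm_num)).abs
  have htest : ∀ φ, IsTest φ → ∫ x in Ioo (0 : ℝ) 1, f x * (Real.sin (Real.pi * x) * φ x) = 0 := by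
    intro φ hφ
    set I := ∫ x in Ioo (0 : ℝ) 1, f x * (Real.sin (Real.pi * x) * φ x) with hI
    set N := ∫ x in Ioo (0 : ℝ) 1, |f x| with hN
    have hN0 : 0 ≤ N := integral_nonneg fun x => abs_nonneg _
    by_contra hne
    have hpos : 0 < |I| / (N + 1) := div_pos (abs_pos.2 hne) (by linarith)
    -- On `[0,1]` the test function is a continuous function of `cos (π x)`.
    have hcψ : Continuous fun y => φ (Real.arccos y / Real.pi) :=
      hφ.continuous.comp (Real.continuous_arccos.div_const _)
    obtain ⟨q, hq⟩ := exists_polynomial_near_of_continuousOn (-1) 1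
      (fun y => φ (Real.arccos y / Real.pi)) hcψ.continuousOn _ hpos
    have hd : I = ∫ x in Ioo (0 : ℝ) 1, f x *
        (Real.sin (Real.pi * x) * (φ x - q.eval (Real.cos (Real.pi * x)))) := by
      simp_rw [mul_sub]
      rw [integral_sub, hpoly, sub_zero]
      · exact integrable_mul_of_continuous f (hcs.mul hφ.continuous)
      · exact integrable_mul_of_continuous f (hcs.mul (q.continuous.comp (by fun_prop)))
    have hle : |I| ≤ |I| / (N + 1) * N := by
      rw [hN, ← integral_const_mul]
      nth_rw 1 [hd]
      rw [← Real.norm_eq_abs]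
      refine norm_integral_le_of_norm_le (hfi.const_mul _) ?_
      filter_upwards [ae_restrict_mem measurableSet_Ioo] with x hx
      have h1 := hq (Real.cos (Real.pi * x)) ⟨Real.neg_one_le_cos _, Real.cos_le_one _⟩
      rw [Real.arccos_cos (by nlinarith [Real.pi_pos, hx.1]) (by nlinarith [Real.pi_pos, hx.2]),
        mul_div_cancel_left₀ _ Real.pi_ne_zero, abs_sub_comm] at h1
      rw [norm_mul, norm_mul, Real.norm_eq_abs, Real.norm_eq_abs, Real.norm_eq_abs, mul_comm]
      refine mul_le_mul_of_nonneg_right ?_ (abs_nonneg _)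
      calc |Real.sin (Real.pi * x)| * |φ x - q.eval (Real.cos (Real.pi * x))|
          ≤ 1 * |φ x - q.eval (Real.cos (Real.pi * x))| :=
            mul_le_mul_of_nonneg_right (Real.abs_sin_le_one _) (abs_nonneg _)
        _ ≤ _ := by rw [one_mul]; exact h1.le
    have hI0 : 0 < |I| := abs_pos.2 hne
    have : |I| / (N + 1) * N < |I| := by
      rw [div_mul_eq_mul_div, div_lt_iff₀ (by linarith)]
      nlinarith
    linarith
  have hsm : MemLp (fun x => f x * Real.sin (Real.pi * x)) 2 volD := by
    refine MemLp.of_le (Lp.memLp f) ((Lp.aestronglyMeasurable f).mul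
      hcs.aestronglyMeasurable) (.of_forall fun x => ?_)
    rw [norm_mul]
    exact mul_le_of_le_one_right (norm_nonneg _) (Real.abs_sin_le_one _)
  have h0 : (hsm.toLp _ : L2D) = 0 := by
    refine eq_zero_of_forall_test fun φ hφ => ?_
    refine (integral_congr_ae ?_).trans (htest φ hφ)
    filter_upwards [hsm.coeFn_toLp] with x hx
    rw [hx]; ring
  rw [Lp.eq_zero_iff_ae_eq_zero] at h0 ⊢
  filter_upwards [h0, hsm.coeFn_toLp, ae_restrict_mem measurableSet_Ioo] with x h1 h2 hx
  rw [h2] at h1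
  refine (mul_eq_zero.1 h1).resolve_right (Real.sin_pos_of_pos_of_lt_pi ?_ ?_).ne'
  · exact mul_pos Real.pi_pos hx.1
  · nlinarith [Real.pi_pos, hx.2]

lemma orthonormal_sinL : Orthonormal ℝ fun k : ℕ => sinL (k + 1) :=
  ⟨fun k => norm_sinL k.succ_pos, fun j k hjk =>
    inner_sinL_of_ne j.succ_pos k.succ_pos (by omega)⟩

lemma eq_of_forall_inner_sinL {f g : L2D}
    (h : ∀ k : ℕ, 0 < k → inner ℝ f (sinL k) = inner ℝ g (sinL k)) : f = g := by
  rw [← sub_eq_zero]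
  exact eq_zero_of_forall_inner_sinL fun k hk => by rw [inner_sub_left, h k hk, sub_self]

/-- The sine system as a Hilbert basis of `L²(D)`. -/
def sineBasis : HilbertBasis ℕ ℝ L2D :=
  HilbertBasis.mkOfOrthogonalEqBot orthonormal_sinL <| by
    rw [Submodule.eq_bot_iff]
    intro f hf
    refine eq_zero_of_forall_inner_sinL fun k hk => ?_
    have hmem : sinL k ∈ Submodule.span ℝ (range fun k : ℕ => sinL (k + 1)) :=
      Submodule.subset_span ⟨k - 1, by simp [Nat.sub_add_cancel hk]⟩
    exact Submodule.inner_left_of_mem_orthogonal hmem hf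

/-- A function in `Ḣ⁴(D)` is recovered from its fourth weak derivative by solving the boundary value
problem of second order twice. -/
lemma MemHdot.eq_G_G {u : L2D} (hu : MemHdot 4 u) : u = G (G (weakDeriv 4 u)) := by
  have hsq : Summable fun k : ℕ => (lam (k + 1) ^ 4 * inner ℝ u (sinL (k + 1))) ^ 2 := by
    refine hu.congr fun k => ?_
    rw [inner_sinL, mul_pow, ← pow_mul]
    congr 1
    rw [show (2 * 4 : ℝ) = ((4 * 2 : ℕ) : ℝ) by norm_num, Real.rpow_natCast]
  have hmem : Memℓp (fun k : ℕ => lam (k + 1) ^ 4 * inner ℝ u (sinL (k + 1))) 2 := by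
    refine memℓp_gen (hsq.congr fun k => ?_)
    rw [ENNReal.toReal_ofNat, Real.rpow_ofNat, Real.norm_eq_abs, sq_abs]
  obtain ⟨w, hw⟩ := sineBasis.repr.surjective ⟨_, hmem⟩
  -- `w` is the function whose Fourier coefficients are those expected of `∂ₓ⁴ u`.
  have hcoef : ∀ k : ℕ, 0 < k → inner ℝ w (sinL k) = lam k ^ 4 * inner ℝ u (sinL k) := by
    intro k hk
    obtain ⟨j, rfl⟩ : ∃ j, k = j + 1 := ⟨k - 1, by omega⟩
    have h1 := sineBasis.repr_apply_apply w j
    rw [hw] at h1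
    rw [real_inner_comm]
    simpa [sineBasis] using h1.symm
  have huw : u = G (G w) := by
    refine eq_of_forall_inner_sinL fun k hk => ?_
    have hl := (lam_pos hk).ne'
    rw [G_symm, G_symm, G_sinL hk, map_smul, G_sinL hk, smul_smul, real_inner_smul_right,
      hcoef k hk]
    field_simp
  have hwd : IsWeakDeriv 4 u w := by
    rw [huw, G_apply, G_apply w]
    exact (((isWeakDeriv_primL _).succ (isWeakDeriv_primL_Q0 _)).succ (isWeakDeriv_primL _)).succ
      (isWeakDeriv_primL_Q0 w)
  rw [hwd.weakDeriv_eq]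
  exact huw

lemma MemHdot.add {s : ℝ} {u v : L2D} (hu : MemHdot s u) (hv : MemHdot s v) :
    MemHdot s (u + v) := by
  unfold MemHdot at *
  simp_rw [← inner_sinL] at *
  refine Summable.of_nonneg_of_le (fun k => ?_) (fun k => ?_)
    ((hu.mul_left 2).add (hv.mul_left 2))
  · have := (lam_pos k.succ_pos).le
    positivity
  · have h : 0 ≤ lam (k + 1) ^ (2 * s) := Real.rpow_nonneg (lam_pos k.succ_pos).le _
    rw [inner_add_left]
    nlinarith [mul_nonneg h
      (sq_nonneg (inner ℝ u (sinL (k + 1)) - inner ℝ v (sinL (k + 1))))]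

lemma MemHdot.smul {s : ℝ} {u : L2D} (c : ℝ) (hu : MemHdot s u) : MemHdot s (c • u) := by
  unfold MemHdot at *
  simp_rw [← inner_sinL] at *
  refine (hu.mul_left (c ^ 2)).congr fun k => ?_
  rw [real_inner_smul_left]; ring

lemma memHdot_zero (s : ℝ) : MemHdot s 0 := by
  unfold MemHdot
  simp_rw [← inner_sinL, inner_zero_left]
  simp [summable_zero]

/-! ### Approximation by piecewise polynomials -/

namespace Mesh

variable (K : Mesh)

/-- The `j`-th interval of the partition. -/
def interval (j : Fin K.J) : Set ℝ := Ioo (K.node j.castSucc) (K.node j.succ)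

lemma node_mem (i : Fin (K.J + 1)) : K.node i ∈ Icc (0 : ℝ) 1 :=
  ⟨K.node_zero ▸ K.strictMono.monotone (Fin.zero_le i),
    K.node_last ▸ K.strictMono.monotone (Fin.le_last i)⟩

lemma node_lt (j : Fin K.J) : K.node j.castSucc < K.node j.succ :=
  K.strictMono Fin.castSucc_lt_succ

lemma interval_subset (j : Fin K.J) : K.interval j ⊆ Ioo 0 1 :=
  Ioo_subset_Ioo (K.node_mem _).1 (K.node_mem _).2

lemma length_le_h (j : Fin K.J) : K.node j.succ - K.node j.castSucc ≤ K.h :=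
  le_ciSup (f := fun j : Fin K.J => K.node j.succ - K.node j.castSucc) (finite_range _).bddAbove j

lemma J_pos : 0 < K.J := by
  rcases Nat.eq_zero_or_pos K.J with h | h
  · have h0 : Fin.last K.J = 0 := by ext; simp [h]
    have := K.node_last
    rw [h0, K.node_zero] at this
    norm_num at this
  · exact h

lemma h_pos : 0 < K.h :=
  (sub_pos.2 (K.node_lt ⟨0, K.J_pos⟩)).trans_le (K.length_le_h _)

lemma h_le_one : K.h ≤ 1 := by
  have : Nonempty (Fin K.J) := ⟨⟨0, K.J_pos⟩⟩
  exact ciSup_le fun j => by linarith [(K.node_mem j.succ).2, (K.node_mem j.castSucc).1]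

lemma integral_eq_sum {u : ℝ → ℝ} (hu : IntegrableOn u (Ioo 0 1)) :
    ∫ x in Ioo (0 : ℝ) 1, u x = ∑ j, ∫ x in K.interval j, u x := by
  let a : ℕ → ℝ := fun n => if hn : n < K.J + 1 then K.node ⟨n, hn⟩ else 1
  have ha : ∀ n (hn : n < K.J + 1), a n = K.node ⟨n, hn⟩ := fun n hn => dif_pos hn
  have hmem : ∀ n, a n ∈ Icc (0 : ℝ) 1 := fun n => by
    by_cases hn : n < K.J + 1
    · rw [ha n hn]; exact K.node_mem _
    · simp only [a, dif_neg hn]; norm_num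
  have hui : IntervalIntegrable u volume 0 1 := by
    rwa [intervalIntegrable_iff_integrableOn_Ioo_of_le zero_le_one]
  have h := intervalIntegral.sum_integral_adjacent_intervals (a := a) (n := K.J) (μ := volume)
    (f := u) fun k _ => hui.mono_set (by
      rw [uIcc_of_le (zero_le_one (α := ℝ))]
      exact uIcc_subset_Icc (hmem _) (hmem _))
  have h0 : a 0 = 0 := by rw [ha 0 (by omega)]; exact K.node_zero
  have h1 : a K.J = 1 := by rw [ha K.J (by omega)]; exact K.node_last
  rw [h0, h1, intervalIntegral_zero_one, Finset.sum_range] at h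
  rw [← h]
  refine Finset.sum_congr rfl fun j _ => ?_
  rw [ha j (by omega), ha (j + 1) (by omega)]
  exact (intervalIntegral.integral_of_le (K.node_lt j).le).trans integral_Ioc_eq_integral_Ioo

/-- The indicator function of the `j`-th interval of the partition. -/
def ind (j : Fin K.J) : L2D :=
  indicatorConstLp 2 (measurableSet_Ioo (a := K.node j.castSucc) (b := K.node j.succ))
    (measure_ne_top volD _) (1 : ℝ)

lemma inner_ind (f : L2D) (j : Fin K.J) :
    inner ℝ f (K.ind j) = ∫ x in K.interval j, f x := by
  rw [real_inner_comm, ind, L2.inner_indicatorConstLp_one]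
  exact congrArg (fun μ => ∫ x, f x ∂μ)
    (Measure.restrict_restrict_of_subset (K.interval_subset j))

/-- The piecewise constant functions. -/
def piecewiseConst : Submodule ℝ L2D := Submodule.span ℝ (range K.ind)

instance : FiniteDimensional ℝ K.piecewiseConst :=
  FiniteDimensional.span_of_finite ℝ (finite_range _)

/-- The orthogonal projection onto the piecewise constant functions. -/
def P0 : L2D →L[ℝ] L2D := K.piecewiseConst.starProjection

lemma integral_sub_P0 (f : L2D) (j : Fin K.J) : ∫ x in K.interval j, (f - K.P0 f) x = 0 := by
  rw [← inner_ind]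
  exact Submodule.starProjection_inner_eq_zero _ _ (Submodule.subset_span ⟨j, rfl⟩)

/-- A function whose mean on each interval vanishes has a primitive that vanishes at the nodes. -/
lemma prim_node {w : L2D} (hw : ∀ j, ∫ x in K.interval j, w x = 0) (i : Fin (K.J + 1)) :
    prim w (K.node i) = 0 := by
  induction i using Fin.induction with
  | zero => rw [K.node_zero, prim_zero]
  | succ j ih =>
    have h := prim_sub_prim w (K.node j.castSucc) (K.node j.succ)
    rw [ih, integral_zeroExt_of_mem w (K.node_mem _).1 (K.node_lt j).le (K.node_mem _).2,
      sub_zero] at h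
    exact h.trans (hw j)

lemma integrable_sq_interval (w : L2D) (j : Fin K.J) :
    IntegrableOn (fun x => w x ^ 2) (K.interval j) :=
  IntegrableOn.mono_set (t := Ioo (0 : ℝ) 1) (Lp.memLp w).integrable_sq (K.interval_subset j)

/-- The basic gain of one power of the mesh-length. -/
lemma norm_primL_le_h {w : L2D} (hw : ∀ j, ∫ x in K.interval j, w x = 0) :
    ‖primL w‖ ≤ K.h * ‖w‖ := by
  have hh := K.h_pos.le
  refine (pow_le_pow_iff_left₀ (norm_nonneg _) (mul_nonneg hh (norm_nonneg _))
    (by norm_num : 2 ≠ 0)).1 ?_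
  rw [mul_pow, norm_sq_eq_integral, norm_sq_eq_integral,
    K.integral_eq_sum (Lp.memLp (primL w)).integrable_sq,
    K.integral_eq_sum (Lp.memLp w).integrable_sq, Finset.mul_sum]
  refine Finset.sum_le_sum fun j _ => ?_
  set I := ∫ x in K.interval j, w x ^ 2 with hI
  have hI0 : 0 ≤ I := integral_nonneg fun x => sq_nonneg _
  have hpt : ∀ᵐ x ∂(volume.restrict (K.interval j)), (primL w) x ^ 2 ≤ K.h * I := by
    filter_upwards [ae_restrict_of_ae_volD (K.node_mem _).1 (K.node_mem _).2 (coeFn_primL w),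
      ae_restrict_mem measurableSet_Ioo] with x hx hm
    have h0 := prim_sub_prim w (K.node j.castSucc) x
    have hx1 : x ≤ 1 := hm.2.le.trans (K.node_mem _).2
    rw [K.prim_node hw, sub_zero, integral_zeroExt_of_mem w (K.node_mem _).1 hm.1.le hx1] at h0
    rw [hx, h0]
    have hsub : Ioo (K.node j.castSucc) x ⊆ K.interval j := Ioo_subset_Ioo le_rfl hm.2.le
    have hmem : MemLp w 2 (volume.restrict (Ioo (K.node j.castSucc) x)) :=
      (Lp.memLp w).mono_measure (Measure.restrict_mono (hsub.trans (K.interval_subset j)) le_rfl)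
    refine (sq_integral_le hmem).trans ?_
    have h3 : (volume.restrict (Ioo (K.node j.castSucc) x)).real univ = x - K.node j.castSucc := by
      simp [hm.1.le]
    rw [h3]
    refine mul_le_mul ?_ ?_ (integral_nonneg fun x => sq_nonneg _) hh
    · linarith [K.length_le_h j, hm.2]
    · exact setIntegral_mono_set (K.integrable_sq_interval w j) (.of_forall fun t => sq_nonneg _)
        (.of_forall hsub)
  calc ∫ x in K.interval j, (primL w) x ^ 2
      ≤ ∫ x in K.interval j, K.h * I := by
        have : IsFiniteMeasure (volume.restrict (K.interval j)) := by
          unfold interval; infer_instance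
        exact integral_mono_ae (K.integrable_sq_interval _ j) (integrable_const _) hpt
    _ = (K.node j.succ - K.node j.castSucc) * (K.h * I) := by
        rw [setIntegral_const, interval, Real.volume_real_Ioo_of_le (K.node_lt j).le, smul_eq_mul]
    _ ≤ K.h * (K.h * I) := mul_le_mul_of_nonneg_right (K.length_le_h j) (mul_nonneg hh hI0)
    _ = K.h ^ 2 * I := by ring

lemma inner_sub_P0_one (f : L2D) : inner ℝ (f - K.P0 f) one = (0 : ℝ) := by
  rw [inner_one_right, K.integral_eq_sum ((Lp.memLp (f - K.P0 f)).integrable (by norm_num))]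
  exact Finset.sum_eq_zero fun j _ => K.integral_sub_P0 f j

/-- Approximation of an `H¹` function by piecewise constants, dual to `norm_primL_le_h`. -/
lemma norm_sub_P0_le (g : L2D) (c : ℝ) :
    ‖(primL g + c • one) - K.P0 (primL g + c • one)‖ ≤ K.h * ‖g‖ := by
  set f := primL g + c • one with hf
  set w := f - K.P0 f with hw
  have h1 : inner ℝ w w = inner ℝ w f := by
    have : inner ℝ w (K.P0 f) = (0 : ℝ) :=
      Submodule.starProjection_inner_eq_zero _ _ (Submodule.starProjection_apply_mem _ _)
    nth_rw 2 [hw]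
    rw [inner_sub_right, this, sub_zero]
  have h2 : ‖w‖ ^ 2 = -inner ℝ (primL w) g := by
    rw [← real_inner_self_eq_norm_sq, h1, hf, inner_add_right, real_inner_smul_right,
      K.inner_sub_P0_one, mul_zero, add_zero, inner_primL_of_mean_zero (K.inner_sub_P0_one f),
      neg_neg]
  have h3 : ‖w‖ ^ 2 ≤ (K.h * ‖w‖) * ‖g‖ := by
    rw [h2, ← inner_neg_left]
    refine (real_inner_le_norm _ _).trans ?_
    rw [norm_neg]
    exact mul_le_mul_of_nonneg_right (K.norm_primL_le_h (K.integral_sub_P0 f)) (norm_nonneg _)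
  by_contra! hcon
  have := mul_nonneg K.h_pos.le (norm_nonneg g)
  nlinarith

end Mesh

lemma norm_sub_starProjection_le {E : Type*} [NormedAddCommGroup E] [InnerProductSpace ℝ E]
    (Y : Submodule ℝ E) [Y.HasOrthogonalProjection] (v : E) {y : E} (hy : y ∈ Y) :
    ‖v - Y.starProjection v‖ ≤ ‖v - y‖ := by
  rw [Submodule.starProjection_minimal]
  exact ciInf_le ⟨0, by rintro _ ⟨x, rfl⟩; exact norm_nonneg _⟩ (⟨y, hy⟩ : Y)

lemma IsPiecewisePoly.add {p : ℕ} {K : Mesh} {f g : L2D} (hf : IsPiecewisePoly p K f)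
    (hg : IsPiecewisePoly p K g) : IsPiecewisePoly p K (f + g) := by
  intro j
  obtain ⟨q, hq, hfq⟩ := hf j
  obtain ⟨r, hr, hgr⟩ := hg j
  refine ⟨q + r, Polynomial.natDegree_add_le_of_degree_le hq hr, ?_⟩
  filter_upwards [hfq, hgr, ae_restrict_of_ae_volD (K.node_mem _).1 (K.node_mem _).2
    (Lp.coeFn_add f g)] with x e1 e2 e3
  rw [e3, Pi.add_apply, e1, e2, Polynomial.eval_add]

lemma IsPiecewisePoly.smul {p : ℕ} {K : Mesh} {f : L2D} (c : ℝ) (hf : IsPiecewisePoly p K f) :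
    IsPiecewisePoly p K (c • f) := by
  intro j
  obtain ⟨q, hq, hfq⟩ := hf j
  refine ⟨c • q, (Polynomial.natDegree_smul_le _ _).trans hq, ?_⟩
  filter_upwards [hfq, ae_restrict_of_ae_volD (K.node_mem _).1 (K.node_mem _).2
    (Lp.coeFn_smul c f)] with x e1 e3
  rw [e3, Pi.smul_apply, e1, Polynomial.eval_smul]

lemma isPiecewisePoly_one (p : ℕ) (K : Mesh) : IsPiecewisePoly p K one := by
  intro j
  refine ⟨1, by simp, ?_⟩
  filter_upwards [ae_restrict_of_ae_volD (K.node_mem _).1 (K.node_mem _).2 coeFn_one] with x hx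
  rw [hx, Polynomial.eval_one]

lemma isPiecewisePoly_of_mem_piecewiseConst {K : Mesh} {g : L2D} (hg : g ∈ K.piecewiseConst) :
    IsPiecewisePoly 0 K g := by
  induction hg using Submodule.span_induction with
  | mem x hx =>
    obtain ⟨i, rfl⟩ := hx
    intro j
    have hco := ae_restrict_of_ae_volD (K.node_mem j.castSucc).1 (K.node_mem j.succ).2
      (indicatorConstLp_coeFn (p := 2)
      (hs := measurableSet_Ioo (a := K.node i.castSucc) (b := K.node i.succ))
      (hμs := measure_ne_top volD _) (c := (1 : ℝ)))
    rcases eq_or_ne i j with rfl | hij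
    · refine ⟨1, by simp, ?_⟩
      filter_upwards [hco, ae_restrict_mem measurableSet_Ioo] with x hx hm
      rw [Mesh.ind, hx, indicator_of_mem hm, Polynomial.eval_one]
    · refine ⟨0, by simp, ?_⟩
      filter_upwards [hco, ae_restrict_mem measurableSet_Ioo] with x hx hm
      rw [Mesh.ind, hx, indicator_of_notMem, Polynomial.eval_zero]
      intro hm'
      rcases lt_or_gt_of_ne hij with h | h
      · have : K.node i.succ ≤ K.node j.castSucc :=
          K.strictMono.monotone (Fin.succ_le_castSucc_iff.2 h)
        exact absurd (hm'.2.trans_le this) (not_lt.2 hm.1.le)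
      · have : K.node j.succ ≤ K.node i.castSucc :=
          K.strictMono.monotone (Fin.succ_le_castSucc_iff.2 h)
        exact absurd (hm.2.trans_le this) (not_lt.2 hm'.1.le)
  | zero =>
    intro j
    refine ⟨0, by simp, ?_⟩
    filter_upwards [ae_restrict_of_ae_volD (K.node_mem _).1 (K.node_mem _).2
      (Lp.coeFn_zero ℝ 2 volD)] with x hx
    rw [hx]; simp
  | add x y _ _ hx hy => exact hx.add hy
  | smul c x _ hx => exact hx.smul c

lemma exists_polynomial_primitive {n : ℕ} (q : Polynomial ℝ) (hq : q.natDegree ≤ n) :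
    ∃ Q : Polynomial ℝ, Q.natDegree ≤ n + 1 ∧ Q.derivative = q := by
  refine ⟨∑ i ∈ Finset.range (n + 1), Polynomial.monomial (i + 1) (q.coeff i / (i + 1)), ?_, ?_⟩
  · refine Polynomial.natDegree_sum_le_of_forall_le _ _ fun i hi => ?_
    refine (Polynomial.natDegree_monomial_le _).trans ?_
    have := Finset.mem_range.1 hi
    omega
  · rw [Polynomial.derivative_sum]
    conv_rhs => rw [q.as_sum_range' (n + 1) (by omega)]
    refine Finset.sum_congr rfl fun i _ => ?_
    rw [Polynomial.derivative_monomial, Nat.add_sub_cancel, Nat.cast_add, Nat.cast_one,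
      div_mul_cancel₀ _ (by positivity)]

lemma IsPiecewisePoly.primL {n : ℕ} {K : Mesh} {g : L2D} (hg : IsPiecewisePoly n K g) :
    IsPiecewisePoly (n + 1) K (primL g) := by
  intro j
  obtain ⟨q, hq, hgq⟩ := hg j
  obtain ⟨Q, hQ, rfl⟩ := exists_polynomial_primitive q hq
  set a := K.node j.castSucc with ha
  refine ⟨Q + Polynomial.C (prim g a - Q.eval a), ?_, ?_⟩
  · exact Polynomial.natDegree_add_le_of_degree_le hQ (by simp)
  · filter_upwards [ae_restrict_of_ae_volD (K.node_mem _).1 (K.node_mem _).2 (coeFn_primL g),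
      ae_restrict_mem measurableSet_Ioo] with x hx hm
    have h0 := prim_sub_prim g a x
    have hx1 : x ≤ 1 := hm.2.le.trans (K.node_mem _).2
    rw [integral_zeroExt_of_mem g (K.node_mem _).1 hm.1.le hx1] at h0
    have h1 : ∫ t in Ioo a x, g t = ∫ t in Ioo a x, Q.derivative.eval t :=
      integral_congr_ae (ae_restrict_of_ae_restrict_of_subset (Ioo_subset_Ioo le_rfl hm.2.le) hgq)
    rw [h1, ← integral_Ioc_eq_integral_Ioo, ← intervalIntegral.integral_of_le hm.1.le,
      intervalIntegral.integral_eq_sub_of_hasDerivAt (fun y _ => Q.hasDerivAt y)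
        (Q.derivative.continuous.intervalIntegrable _ _)] at h0
    rw [hx, Polynomial.eval_add, Polynomial.eval_C]
    linarith

lemma IsPiecewisePoly.G {n : ℕ} {K : Mesh} {g : L2D} (hg : IsPiecewisePoly n K g) :
    IsPiecewisePoly (n + 2) K (G g) := by
  rw [G_apply, Q0_apply, sub_eq_add_neg, ← neg_smul]
  exact (hg.primL.add ((isPiecewisePoly_one _ K).smul _)).primL

/-! ### The Galerkin solution operator -/

/-- The closure of the space of second derivatives of the functions in `S`, these being the `y` with
`G y ∈ S`. -/
def derivSpace (S : Submodule ℝ L2D) : Submodule ℝ L2D :=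
  (S.comap (G : L2D →ₗ[ℝ] L2D)).topologicalClosure

instance (S : Submodule ℝ L2D) : CompleteSpace (derivSpace S) :=
  (Submodule.isClosed_topologicalClosure _).completeSpace_coe

/-- The orthogonal projection onto `derivSpace S`. -/
def projS (S : Submodule ℝ L2D) : L2D →L[ℝ] L2D := (derivSpace S).starProjection

/-- The discrete solution operator of second order; `gram (galerkinG S)` is the Galerkin solution
operator of the fourth order problem, and `gram G` the exact one. -/
def galerkinG (S : Submodule ℝ L2D) : L2D →L[ℝ] L2D := (projS S).comp G

lemma gram_galerkinG (S : Submodule ℝ L2D) (f : L2D) :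
    gram (galerkinG S) f = G (projS S (G f)) := by
  refine ext_inner_right ℝ fun v => ?_
  rw [inner_gram, G_symm]
  change inner ℝ (projS S (G f)) (projS S (G v)) = _
  rw [projS, Submodule.inner_starProjection_left_eq_right,
    Submodule.inner_starProjection_left_eq_right,
    Submodule.starProjection_eq_self_iff.2 (Submodule.starProjection_apply_mem _ _)]

lemma gram_G (f : L2D) : gram G f = G (G f) := by
  refine ext_inner_right ℝ fun v => ?_
  rw [inner_gram, G_symm, G_symm, G_symm]

section FESpace

variable {p : ℕ} {K : Mesh} {S : Submodule ℝ L2D}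

lemma mem_derivSpace {y : L2D} (hy : G y ∈ S) : y ∈ derivSpace S :=
  Submodule.le_topologicalClosure _ hy

lemma IsFESpace.eq_G (hS : IsFESpace p K S) {χ : L2D} (hχ : χ ∈ S) : G (weakDeriv 2 χ) = χ :=
  (eq_G_weakDeriv (hS.memH2 χ hχ) (hS.memH10 χ hχ)).symm

/-- In one space dimension the second derivatives of the finite element functions need not satisfy
any boundary condition, so that the elliptic problem reduces to `L²` approximation. -/
lemma IsFESpace.approx (hp : p = 2 ∨ p = 3) (hS : IsFESpace p K S) (g : L2D) :
    ‖G g - projS S (G g)‖ ≤ K.h * ‖Q0 (primL g)‖ ∧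
      ‖G g - projS S (G g)‖ ≤ K.h ^ (p - 1) * ‖g‖ := by
  have hh := K.h_pos.le
  have hmem : ∀ f : L2D, K.P0 f ∈ K.piecewiseConst := fun f =>
    Submodule.starProjection_apply_mem _ _
  rcases hp with rfl | rfl
  -- For `p = 2` all piecewise constants are second derivatives of functions in `S`.
  · have hY : K.P0 (G g) ∈ derivSpace S := by
      refine mem_derivSpace (hS.splines_mem _ ?_ (memH_two_G _) (memH10_G _))
      exact (isPiecewisePoly_of_mem_piecewiseConst (hmem _)).G
    have h1 : ‖G g - projS S (G g)‖ ≤ K.h * ‖Q0 (primL g)‖ := by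
      refine (norm_sub_starProjection_le _ _ hY).trans ?_
      simpa [G_apply] using K.norm_sub_P0_le (Q0 (primL g)) 0
    refine ⟨h1, h1.trans ?_⟩
    rw [pow_one]
    exact mul_le_mul_of_nonneg_left ((norm_Q0_le _).trans (norm_primL_le g)) hh
  -- For `p = 3` approximate the derivative `z` of `G g` by piecewise constants and integrate;
  -- the primitive of the error vanishes at the nodes.
  · set z := Q0 (primL g) with hz
    have hY : primL (K.P0 z) ∈ derivSpace S := by
      refine mem_derivSpace (hS.splines_mem _ ?_ ?_ (memH10_G _))
      · exact (isPiecewisePoly_of_mem_piecewiseConst (hmem _)).primL.G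
      · intro l hl
        rcases hl.eq_or_lt with rfl | hl
        · exact ⟨_, (isWeakDeriv_G _).succ (isWeakDeriv_primL _)⟩
        · exact memH_two_G _ l (by omega)
    have h0 : ‖G g - projS S (G g)‖ ≤ K.h * ‖z - K.P0 z‖ := by
      refine (norm_sub_starProjection_le _ _ hY).trans ?_
      rw [G_apply, ← map_sub]
      exact K.norm_primL_le_h (K.integral_sub_P0 z)
    constructor
    · refine h0.trans (mul_le_mul_of_nonneg_left ?_ hh)
      have := norm_sub_starProjection_le K.piecewiseConst z (Submodule.zero_mem _)
      rwa [sub_zero] at this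
    · refine h0.trans ?_
      rw [show (3 - 1 : ℕ) = 2 from rfl, sq, mul_assoc]
      refine mul_le_mul_of_nonneg_left ?_ hh
      rw [hz, Q0_apply, sub_eq_add_neg (primL g), ← neg_smul]
      exact K.norm_sub_P0_le g _

/-- The dual bound for the projection error. -/
lemma IsFESpace.norm_G_sub_le (hp : p = 2 ∨ p = 3) (hS : IsFESpace p K S) (f : L2D) :
    ‖G (f - projS S f)‖ ≤ K.h ^ (p - 1) * ‖f - projS S f‖ := by
  set r := f - projS S f with hr
  set v := G r with hv
  have h1 : ‖v‖ ^ 2 = inner ℝ r (G v - projS S (G v)) := by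
    have h2 : inner ℝ r (projS S (G v)) = (0 : ℝ) :=
      Submodule.starProjection_inner_eq_zero _ _ (Submodule.starProjection_apply_mem _ _)
    rw [inner_sub_right, h2, sub_zero, ← G_symm, real_inner_self_eq_norm_sq]
  have h3 : ‖v‖ ^ 2 ≤ ‖r‖ * (K.h ^ (p - 1) * ‖v‖) := by
    rw [h1]
    exact (real_inner_le_norm _ _).trans
      (mul_le_mul_of_nonneg_left (hS.approx hp v).2 (norm_nonneg _))
  by_contra! hcon
  have := mul_nonneg (pow_nonneg K.h_pos.le (p - 1)) (norm_nonneg r)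
  nlinarith

lemma inv_lam_pow_four {k : ℕ} : (lam k ^ 4)⁻¹ = ((lam k ^ 2)⁻¹) ^ 2 := by
  rw [inv_pow, ← pow_mul]

lemma gram_G_sinL {k : ℕ} (hk : 0 < k) : gram G (sinL k) = (lam k ^ 4)⁻¹ • sinL k := by
  rw [gram_G, G_sinL hk, map_smul, G_sinL hk, smul_smul, inv_lam_pow_four]
  congr 1; ring

lemma norm_galerkinG_sinL_sq_le (S : Submodule ℝ L2D) {k : ℕ} (hk : 0 < k) :
    ‖galerkinG S (sinL k)‖ ^ 2 ≤ (lam k ^ 4)⁻¹ := by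
  have h1 : ‖galerkinG S (sinL k)‖ ≤ (lam k ^ 2)⁻¹ := by
    refine (Submodule.norm_starProjection_apply_le (derivSpace S) (G (sinL k))).trans ?_
    rw [G_sinL hk, norm_smul, norm_sinL hk, mul_one, Real.norm_eq_abs, abs_neg, abs_of_nonneg]
    positivity
  rw [inv_lam_pow_four]
  exact pow_le_pow_left₀ (norm_nonneg _) h1 2

/-- The error of the elliptic projection of an eigenfunction: approximation of `eps k` to first
order, times the gain of `h ^ (p - 1)` by duality. -/
lemma IsFESpace.norm_elliptic_error_le (hp : p = 2 ∨ p = 3) (hS : IsFESpace p K S) {k : ℕ}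
    (hk : 0 < k) :
    ‖sinL k - lam k ^ 4 • gram (galerkinG S) (sinL k)‖ ≤ K.h ^ p * lam k ^ 3 := by
  have hl := lam_pos hk
  have h1 : sinL k - lam k ^ 4 • gram (galerkinG S) (sinL k)
      = lam k ^ 4 • G (G (sinL k) - projS S (G (sinL k))) := by
    rw [gram_galerkinG, map_sub, smul_sub, ← gram_G, gram_G_sinL hk, smul_smul,
      mul_inv_cancel₀ (pow_pos hl 4).ne', one_smul]
  rw [h1, norm_smul, Real.norm_eq_abs, abs_of_pos (pow_pos hl 4)]
  have h2 := hS.norm_G_sub_le hp (G (sinL k))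
  have h3 := (hS.approx hp (sinL k)).1
  rw [norm_Q0_primL_sinL hk] at h3
  have h4 := mul_le_mul_of_nonneg_left h3 (pow_nonneg K.h_pos.le (p - 1))
  calc lam k ^ 4 * ‖G (G (sinL k) - projS S (G (sinL k)))‖
      ≤ lam k ^ 4 * (K.h ^ (p - 1) * (K.h * (lam k)⁻¹)) :=
        mul_le_mul_of_nonneg_left (h2.trans h4) (pow_pos hl 4).le
    _ = (K.h ^ (p - 1) * K.h) * lam k ^ 3 := by field_simp
    _ = K.h ^ p * lam k ^ 3 := by
        rw [← pow_succ, Nat.sub_add_cancel (by omega)]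

/-- A step of the fully discrete scheme, with the solution operator applied. -/
lemma IsFESpace.galerkin_step (hS : IsFESpace p K S) {v w f : L2D} {c : ℝ} (hw : w ∈ S)
    (h : ∀ χ ∈ S, inner ℝ v χ + c * bilB w χ = inner ℝ f χ) :
    gram (galerkinG S) (v - f) + c • w = 0 := by
  set y := weakDeriv 2 w with hy
  have hGy : G y = w := hS.eq_G hw
  have hP : projS S (G (v - f)) = -(c • y) := by
    refine Submodule.eq_starProjection_of_mem_orthogonal ?_ ?_
    · exact Submodule.neg_mem _ (Submodule.smul_mem _ _ (mem_derivSpace (by rwa [hGy])))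
    · rw [derivSpace, Submodule.orthogonal_closure, Submodule.mem_orthogonal']
      intro u hu
      have hu' : G u ∈ S := hu
      have h1 := h _ hu'
      rw [bilB, (isWeakDeriv_G u).weakDeriv_eq, ← hy] at h1
      rw [sub_neg_eq_add, inner_add_left, G_symm, inner_sub_left, real_inner_smul_left]
      linarith
  rw [gram_galerkinG, hP, map_neg, map_smul, hGy, neg_add_cancel]

end FESpace

/-- A step of the time-discrete scheme, with the solution operator applied. -/
lemma timeDiscrete_step {u u' f : L2D} {c : ℝ} (hu : MemHdot 4 u) (hu' : MemHdot 4 u')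
    (h : u - u' + c • weakDeriv 4 ((1 / 2 : ℝ) • (u + u')) = f) :
    gram G (u - u' - f) + (c / 2) • (u + u') = 0 := by
  have h1 := ((hu.add hu').smul (1 / 2)).eq_G_G
  rw [← h, sub_add_cancel_left, gram_G, map_neg, map_neg, map_smul, map_smul, ← h1, smul_smul,
    mul_one_div, neg_add_cancel]

/-! ### Sums over the spectrum -/

lemma sum_Icc_le_of_telescope {g F : ℕ → ℝ} {C : ℝ} (h0 : F 0 = 0)
    (h : ∀ n, g (n + 1) ≤ C * (F (n + 1) - F n)) (N : ℕ) :
    ∑ i ∈ Finset.Icc 1 N, g i ≤ C * F N := by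
  induction N with
  | zero => simp [h0]
  | succ n ih => rw [Finset.sum_Icc_succ_top (by omega)]; linarith [h n]

/-- The sum behaves like `∫ min (δ² t², t⁻⁴) dt`; the comparison function is the one with
`F = δ t³ / (1 + δ t³)`, which makes the sum telescope. -/
lemma sum_min_le {δ : ℝ} (hδ : 0 < δ) (N : ℕ) :
    ∑ i ∈ Finset.Icc 1 N, min (δ ^ 2 * (i : ℝ) ^ 2) (1 / (i : ℝ) ^ 4) ≤ 4 * δ := by
  set F : ℕ → ℝ := fun n => δ * (n : ℝ) ^ 3 / (1 + δ * (n : ℝ) ^ 3) with hF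
  have hle : F N ≤ 1 := by
    simp only [hF]
    rw [div_le_one (by positivity)]
    linarith
  refine (sum_Icc_le_of_telescope (F := F) (C := 4 * δ) (by simp [hF]) (fun n => ?_) N).trans ?_
  · set s : ℝ := (n : ℝ) with hs
    have hs0 : 0 ≤ s := Nat.cast_nonneg n
    have hcast : ((n + 1 : ℕ) : ℝ) = s + 1 := by push_cast; rfl
    simp only [hF, hcast]
    set u := δ * (s + 1) ^ 3 with hu
    set v := δ * s ^ 3 with hv
    have hv0 : 0 ≤ v := by positivity
    have hu0 : 0 < u := by positivity
    have huv : δ * (s + 1) ^ 2 ≤ u - v := by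
      rw [hu, hv, ← mul_sub]
      exact mul_le_mul_of_nonneg_left (by nlinarith) hδ.le
    have hvu : v ≤ u := by nlinarith [mul_nonneg hδ.le (sq_nonneg (s + 1))]
    have h1 : u / (1 + u) - v / (1 + v) = (u - v) / ((1 + u) * (1 + v)) := by
      field_simp; ring
    have h2 : δ * (s + 1) ^ 2 / (1 + u) ^ 2 ≤ u / (1 + u) - v / (1 + v) := by
      rw [h1, sq (1 + u)]
      exact div_le_div₀ (by linarith) huv (by positivity)
        (mul_le_mul_of_nonneg_left (by linarith) (by linarith))
    refine le_trans ?_ (mul_le_mul_of_nonneg_left h2 (by positivity))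
    rw [← mul_div_assoc, le_div_iff₀ (by positivity)]
    -- The first member of the minimum is used where it is the smaller one, that is for `u ≤ 1`.
    rcases le_total u 1 with h | h
    · calc _ ≤ δ ^ 2 * (s + 1) ^ 2 * (1 + u) ^ 2 :=
            mul_le_mul_of_nonneg_right (min_le_left _ _) (by positivity)
        _ ≤ δ ^ 2 * (s + 1) ^ 2 * 4 :=
            mul_le_mul_of_nonneg_left (by nlinarith) (by positivity)
        _ = _ := by ring
    · calc _ ≤ 1 / (s + 1) ^ 4 * (1 + u) ^ 2 :=
            mul_le_mul_of_nonneg_right (min_le_right _ _) (by positivity)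
        _ ≤ 1 / (s + 1) ^ 4 * (4 * u ^ 2) :=
            mul_le_mul_of_nonneg_left (by nlinarith) (by positivity)
        _ = _ := by rw [hu]; field_simp
  · nlinarith

/-- The sum behaves like `∫ 1 / (1 + c⁴ t⁴) dt`; it telescopes against `c t / (1 + c t)`. -/
lemma sum_resolvent_le {c : ℝ} (hc : 0 < c) (N : ℕ) :
    ∑ i ∈ Finset.Icc 1 N, 1 / (1 + c ^ 4 * (i : ℝ) ^ 4) ≤ 4 / c := by
  set F : ℕ → ℝ := fun n => c * (n : ℝ) / (1 + c * (n : ℝ)) with hF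
  have hle : F N ≤ 1 := by
    simp only [hF]
    rw [div_le_one (by positivity)]
    linarith
  refine (sum_Icc_le_of_telescope (F := F) (C := 4 / c) (by simp [hF]) (fun n => ?_) N).trans ?_
  · set s : ℝ := (n : ℝ) with hs
    have hs0 : 0 ≤ s := Nat.cast_nonneg n
    have hcast : ((n + 1 : ℕ) : ℝ) = s + 1 := by push_cast; rfl
    simp only [hF, hcast]
    set v := c * (s + 1) with hv
    have hv0 : 0 < v := by positivity
    have h1 : v / (1 + v) - c * s / (1 + c * s) = c / ((1 + v) * (1 + c * s)) := by
      rw [hv]; field_simp; ring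
    have h2 : c / (1 + v) ^ 2 ≤ v / (1 + v) - c * s / (1 + c * s) := by
      rw [h1, sq (1 + v)]
      refine div_le_div_of_nonneg_left hc.le (by positivity)
        (mul_le_mul_of_nonneg_left (by rw [hv]; nlinarith) (by linarith))
    refine le_trans ?_ (mul_le_mul_of_nonneg_left h2 (by positivity))
    rw [← mul_pow, ← hv, div_mul_div_comm, mul_comm 4 c, mul_div_mul_left _ _ hc.ne',
      div_le_div_iff₀ (by positivity) (by positivity)]
    nlinarith [sq_nonneg (v - 1), sq_nonneg (v ^ 2 - 1), sq_nonneg v]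
  · have : 0 ≤ 4 / c := by positivity
    nlinarith

/-- The sum over the modes of the bounds for the deterministic error. The first part is the error in
space; the second one is the trace of the resolvent, which is where the exponent `3/4` of the step
comes from. -/
lemma sum_mode_error_le {δ k : ℝ} (hδ : 0 < δ) (hk : 0 < k) {E : ℕ → ℝ}
    (hE : ∀ i, 0 < i → E i ≤ δ * lam i ^ 3) (hE0 : ∀ i, 0 ≤ E i) (N : ℕ) :
    ∑ i ∈ Finset.Icc 1 N, (min (3 / 2 * (E i ^ 2 / lam i ^ 4)) (4 / lam i ^ 4)
      + 2 * k / (1 + k * lam i ^ 4 / 2)) ≤ 64 * δ + 8 * k ^ (3 / 4 : ℝ) := by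
  set c := k ^ (1 / 4 : ℝ) with hc
  have hc0 : 0 < c := Real.rpow_pos_of_pos hk _
  have hc4 : c ^ 4 = k := by
    rw [hc, ← Real.rpow_natCast, ← Real.rpow_mul hk.le]; norm_num
  have hkc : k / c = k ^ (3 / 4 : ℝ) := by
    rw [hc]
    nth_rw 1 [← Real.rpow_one k]
    rw [← Real.rpow_sub hk]; norm_num
  have h1 := sum_min_le hδ N
  have h2 := sum_resolvent_le hc0 N
  have hpi3 := Real.pi_gt_three
  have hpi4 := Real.pi_lt_d2
  have hterm : ∀ i ∈ Finset.Icc 1 N, min (3 / 2 * (E i ^ 2 / lam i ^ 4)) (4 / lam i ^ 4)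
      + 2 * k / (1 + k * lam i ^ 4 / 2) ≤
      16 * min (δ ^ 2 * (i : ℝ) ^ 2) (1 / (i : ℝ) ^ 4)
        + 2 * k * (1 / (1 + c ^ 4 * (i : ℝ) ^ 4)) := by
    intro i hi
    have hi0 : 0 < i := (Finset.mem_Icc.1 hi).1
    have hir : (0 : ℝ) < i := Nat.cast_pos.2 hi0
    have hl := lam_pos hi0
    have hπ2 : Real.pi ^ 2 ≤ 10 := by nlinarith
    have hπ4 : 2 ≤ Real.pi ^ 4 := by
      have : (3 : ℝ) ^ 4 ≤ Real.pi ^ 4 := pow_le_pow_left₀ (by norm_num) hpi3.le 4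
      linarith
    have hl2 : lam i ^ 2 = Real.pi ^ 2 * (i : ℝ) ^ 2 := by unfold lam; ring
    have hl4 : lam i ^ 4 = Real.pi ^ 4 * (i : ℝ) ^ 4 := by unfold lam; ring
    refine add_le_add ?_ ?_
    · rw [mul_min_of_nonneg _ _ (by norm_num : (0 : ℝ) ≤ 16)]
      refine min_le_min ?_ ?_
      · have e1 : E i ^ 2 ≤ (δ * lam i ^ 3) ^ 2 := pow_le_pow_left₀ (hE0 i) (hE i hi0) 2
        calc 3 / 2 * (E i ^ 2 / lam i ^ 4) ≤ 3 / 2 * ((δ * lam i ^ 3) ^ 2 / lam i ^ 4) := by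
              gcongr
          _ = 3 / 2 * (δ ^ 2 * (Real.pi ^ 2 * (i : ℝ) ^ 2)) := by rw [← hl2]; field_simp
          _ ≤ 3 / 2 * (δ ^ 2 * (10 * (i : ℝ) ^ 2)) := by gcongr
          _ ≤ 16 * (δ ^ 2 * (i : ℝ) ^ 2) := by
              nlinarith [mul_nonneg (sq_nonneg δ) (sq_nonneg (i : ℝ))]
      · rw [hl4, mul_one_div, div_le_div_iff₀ (by positivity) (by positivity)]
        nlinarith [pow_pos hir 4]
    · rw [mul_one_div, hc4]
      refine div_le_div_of_nonneg_left (by positivity) (by positivity) ?_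
      rw [hl4]
      nlinarith [mul_pos hk (pow_pos hir 4)]
  refine (Finset.sum_le_sum hterm).trans ?_
  rw [Finset.sum_add_distrib, ← Finset.mul_sum, ← Finset.mul_sum]
  have h3 := mul_le_mul_of_nonneg_left h2 (by positivity : 0 ≤ 2 * k)
  have h4 : 2 * k * (4 / c) = 8 * k ^ (3 / 4 : ℝ) := by rw [← hkc]; ring
  linarith

/-! ### The noise and the load -/

lemma measurableSet_cell (δ : ℝ) (n : ℕ) : MeasurableSet (cell δ n) := measurableSet_Ioo

lemma volume_cell_ne_top (δ : ℝ) (n : ℕ) : volume (cell δ n) ≠ ⊤ := by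
  unfold cell; simp

lemma volume_real_cell {δ : ℝ} (hδ : 0 ≤ δ) (n : ℕ) : volume.real (cell δ n) = δ := by
  rw [cell, Real.volume_real_Ioo_of_le (by nlinarith)]; ring

lemma cell_disjoint {δ : ℝ} (hδ : 0 ≤ δ) {m n : ℕ} (h : m ≠ n) :
    Disjoint (cell δ m) (cell δ n) := by
  wlog hmn : m < n generalizing m n
  · exact (this h.symm (by omega)).symm
  rw [Set.disjoint_left]
  intro x hx hx'
  have h1 : (m : ℝ) ≤ n - 1 := by
    have : (m : ℝ) + 1 ≤ n := by exact_mod_cast hmn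
    linarith
  have h2 := mul_le_mul_of_nonneg_right h1 hδ
  linarith [hx.2, hx'.1]

lemma cell_subset {T : ℝ} (hT : 0 < T) {N n : ℕ} (hn : n ∈ Finset.Icc 1 N) :
    cell (T / N) n ⊆ Ioo 0 T := by
  rw [Finset.mem_Icc] at hn
  have hN : (0 : ℝ) < N := by exact_mod_cast (by omega : 0 < N)
  have h1 : (1 : ℝ) ≤ n := by exact_mod_cast hn.1
  have h2 : (n : ℝ) ≤ N := by exact_mod_cast hn.2
  refine Ioo_subset_Ioo (mul_nonneg (by linarith) (by positivity)) ?_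
  calc (n : ℝ) * (T / N) ≤ N * (T / N) := mul_le_mul_of_nonneg_right h2 (by positivity)
    _ = T := by field_simp

lemma sum_volume_inter_cell_le {δ : ℝ} (hδ : 0 ≤ δ) (s : Finset ℕ) {A : Set ℝ}
    (hA : MeasurableSet A) (hAf : volume A ≠ ⊤) :
    ∑ n ∈ s, volume.real (A ∩ cell δ n) ≤ volume.real A := by
  rw [← measureReal_biUnion_finset (fun i _ j _ hij =>
      (cell_disjoint hδ hij).mono inter_subset_right inter_subset_right)
    (fun b _ => hA.inter (measurableSet_cell _ _))
    (fun b _ => measure_ne_top_of_subset inter_subset_left hAf)]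
  exact measureReal_mono (iUnion₂_subset fun _ _ => inter_subset_left) hAf

lemma inner_mode {T : ℝ} (hT : 0 < T) {N n n' i i' : ℕ} (hn : n ∈ Finset.Icc 1 N)
    (hi : 0 < i) (hi' : 0 < i') :
    inner ℝ ((memLp_mode T (T / N) n i).toLp (mode (T / N) n i))
      ((memLp_mode T (T / N) n' i').toLp (mode (T / N) n' i')) =
      if n = n' ∧ i = i' then T / N else 0 := by
  have hδ : 0 ≤ T / N := by positivity
  have h1 : inner ℝ ((memLp_mode T (T / N) n i).toLp (mode (T / N) n i))
      ((memLp_mode T (T / N) n' i').toLp (mode (T / N) n' i')) =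
      (∫ t in Ioo 0 T, (cell (T / N) n ∩ cell (T / N) n').indicator (fun _ => (1 : ℝ)) t) *
        ∫ x in Ioo (0 : ℝ) 1, eps i x * eps i' x := by
    rw [L2.inner_def, ← setIntegral_prod_mul, ← Measure.volume_eq_prod]
    refine integral_congr_ae ?_
    filter_upwards [(memLp_mode T (T / N) n i).coeFn_toLp,
      (memLp_mode T (T / N) n' i').coeFn_toLp] with z e1 e2
    rw [e1, e2]
    by_cases h : z.1 ∈ cell (T / N) n <;> by_cases h' : z.1 ∈ cell (T / N) n' <;>
      simp [mode, h, h', mul_comm]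
  have h2 : ∫ x in Ioo (0 : ℝ) 1, eps i x * eps i' x = inner ℝ (sinL i) (sinL i') := by
    rw [inner_sinL]
    refine integral_congr_ae ?_
    filter_upwards [coeFn_sinL i] with x hx
    rw [hx]
  rw [h1, h2]
  by_cases hnn : n = n'
  · subst hnn
    by_cases hii : i = i'
    · subst hii
      rw [if_pos ⟨rfl, rfl⟩, real_inner_self_eq_norm_sq, norm_sinL hi, inter_self,
        setIntegral_indicator (measurableSet_cell _ _),
        inter_eq_self_of_subset_right (cell_subset hT hn), setIntegral_const,
        volume_real_cell hδ]
      simp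
    · rw [if_neg (fun h => hii h.2), inner_sinL_of_ne hi hi' hii, mul_zero]
  · rw [if_neg (fun h => hnn h.1), (cell_disjoint hδ hnn).inter_eq]
    simp

section Noise

variable {T : ℝ} {Ω : Type*} [MeasurableSpace Ω] {P : Measure Ω}
  {W : Lp ℝ 2 (volO T) → Ω → ℝ}

lemma IsWhiteNoise.integrable_mul [IsProbabilityMeasure P] (hW : IsWhiteNoise T P W)
    (g g' : Lp ℝ 2 (volO T)) : Integrable (fun ω => W g ω * W g' ω) P :=
  (hW.gaussian.hasGaussianLaw_eval g).memLp_two.integrable_mul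
    (hW.gaussian.hasGaussianLaw_eval g').memLp_two

/-- Itô's isometry for the finitely many noise coefficients of the load. -/
lemma IsWhiteNoise.isometry [IsProbabilityMeasure P] (hW : IsWhiteNoise T P W) (hT : 0 < T)
    {H : Type*} [NormedAddCommGroup H] [InnerProductSpace ℝ H] (Mstar Nstar : ℕ)
    (v : ℕ × ℕ → H) :
    Integrable (fun ω => ‖∑ a ∈ Finset.Icc 1 Nstar ×ˢ Finset.Icc 1 Mstar,
        noiseCoeff T W (T / Nstar) a.1 a.2 ω • v a‖ ^ 2) P ∧
      ∫ ω, ‖∑ a ∈ Finset.Icc 1 Nstar ×ˢ Finset.Icc 1 Mstar,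
        noiseCoeff T W (T / Nstar) a.1 a.2 ω • v a‖ ^ 2 ∂P =
      T / Nstar * ∑ a ∈ Finset.Icc 1 Nstar ×ˢ Finset.Icc 1 Mstar, ‖v a‖ ^ 2 := by
  set s := Finset.Icc 1 Nstar ×ˢ Finset.Icc 1 Mstar with hs
  have hexp : ∀ ω, ‖∑ a ∈ s, noiseCoeff T W (T / Nstar) a.1 a.2 ω • v a‖ ^ 2 =
      ∑ a ∈ s, ∑ b ∈ s, (noiseCoeff T W (T / Nstar) a.1 a.2 ω *
        noiseCoeff T W (T / Nstar) b.1 b.2 ω) * inner ℝ (v a) (v b) := by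
    intro ω
    rw [← real_inner_self_eq_norm_sq, sum_inner]
    refine Finset.sum_congr rfl fun a _ => ?_
    rw [inner_sum]
    refine Finset.sum_congr rfl fun b _ => ?_
    rw [real_inner_smul_left, real_inner_smul_right]; ring
  have hint : ∀ a b : ℕ × ℕ, Integrable (fun ω => (noiseCoeff T W (T / Nstar) a.1 a.2 ω *
        noiseCoeff T W (T / Nstar) b.1 b.2 ω) * inner ℝ (v a) (v b)) P := fun a b =>
    (hW.integrable_mul _ _).mul_const _
  simp_rw [hexp]
  refine ⟨integrable_finsetSum _ fun a _ => integrable_finsetSum _ fun b _ => hint a b, ?_⟩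
  rw [integral_finsetSum _ fun a _ => integrable_finsetSum _ fun b _ => hint a b,
    Finset.mul_sum]
  refine Finset.sum_congr rfl fun a ha => ?_
  rw [integral_finsetSum _ fun b _ => hint a b, Finset.sum_eq_single a]
  · rw [integral_mul_const]
    unfold noiseCoeff
    rw [hs, Finset.mem_product] at ha
    rw [hW.covariance, inner_mode hT ha.1 (Finset.mem_Icc.1 ha.2).1 (Finset.mem_Icc.1 ha.2).1,
      if_pos ⟨rfl, rfl⟩, real_inner_self_eq_norm_sq]
  · intro b hb hba
    rw [integral_mul_const]
    unfold noiseCoeff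
    rw [hs, Finset.mem_product] at ha hb
    rw [hW.covariance, inner_mode hT ha.1 (Finset.mem_Icc.1 ha.2).1 (Finset.mem_Icc.1 hb.2).1,
      if_neg, zero_mul]
    rintro ⟨h1, h2⟩
    exact hba (Prod.ext h1.symm h2.symm)
  · exact fun h => absurd ha h

end Noise

/-- The weight with which the noise on the `n`-th cell of the load enters the `l`-th time step. -/
def overlap (Δτ Δt : ℝ) (l n : ℕ) : ℝ := volume.real (cell Δτ l ∩ cell Δt n) / Δt

lemma overlap_nonneg {Δτ Δt : ℝ} (ht : 0 ≤ Δt) (l n : ℕ) : 0 ≤ overlap Δτ Δt l n :=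
  div_nonneg measureReal_nonneg ht

lemma sum_overlap_left_le {Δτ Δt : ℝ} (hτ : 0 ≤ Δτ) (ht : 0 < Δt) (s : Finset ℕ) (n : ℕ) :
    ∑ l ∈ s, overlap Δτ Δt l n ≤ 1 := by
  unfold overlap
  rw [← Finset.sum_div, div_le_one ht]
  simp_rw [inter_comm (cell Δτ _)]
  exact (sum_volume_inter_cell_le hτ s (measurableSet_cell _ _) (volume_cell_ne_top _ _)).trans
    (volume_real_cell ht.le n).le

lemma sum_overlap_right_le {Δτ Δt : ℝ} (hτ : 0 ≤ Δτ) (ht : 0 < Δt) (s : Finset ℕ) (l : ℕ) :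
    Δt * ∑ n ∈ s, overlap Δτ Δt l n ≤ Δτ := by
  unfold overlap
  rw [← Finset.sum_div, mul_div_cancel₀ _ ht.ne']
  exact (sum_volume_inter_cell_le ht.le s (measurableSet_cell _ _) (volume_cell_ne_top _ _)).trans
    (volume_real_cell hτ l).le

lemma integral_sum_indicator {A : Set ℝ} (hAf : volume A ≠ ⊤) (δ : ℝ)
    (s : Finset ℕ) (a : ℕ → ℝ) :
    ∫ t in A, ∑ n ∈ s, (cell δ n).indicator (fun _ => a n) t =
      ∑ n ∈ s, volume.real (A ∩ cell δ n) * a n := by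
  have hfin : IsFiniteMeasure (volume.restrict A) := ⟨by simpa using hAf.lt_top⟩
  rw [integral_finsetSum _ fun n _ => (integrable_const _).indicator (measurableSet_cell _ _)]
  refine Finset.sum_congr rfl fun n _ => ?_
  rw [setIntegral_indicator (measurableSet_cell _ _), setIntegral_const, smul_eq_mul]

lemma coeFn_finsetSum_L2D {ι : Type*} (s : Finset ι) (f : ι → L2D) :
    ∀ᵐ x ∂volD, (∑ a ∈ s, f a : L2D) x = ∑ a ∈ s, f a x := by
  classical
  induction s using Finset.induction_on with
  | empty =>
    filter_upwards [Lp.coeFn_zero ℝ 2 volD] with x hx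
    rw [Finset.sum_empty, Finset.sum_empty, hx, Pi.zero_apply]
  | insert a s ha ih =>
    rw [Finset.sum_insert ha]
    filter_upwards [ih, Lp.coeFn_add (f a) (∑ a ∈ s, f a)] with x e1 e2
    rw [e2, Pi.add_apply, e1, Finset.sum_insert ha]

section Load

variable (T : ℝ) {Ω : Type*} (W : Lp ℝ 2 (volO T) → Ω → ℝ) (Mstar Nstar : ℕ)

/-- The load `∫_{Δ_l} Ŵ ds` of the `l`-th time step, as an element of `L²(D)`. -/
def loadL (Δτ : ℝ) (l : ℕ) (ω : Ω) : L2D :=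
  ∑ a ∈ Finset.Icc 1 Nstar ×ˢ Finset.Icc 1 Mstar,
    noiseCoeff T W (T / Nstar) a.1 a.2 ω • overlap Δτ (T / Nstar) l a.1 • sinL a.2

lemma coeFn_loadL (Δτ : ℝ) (l : ℕ) (ω : Ω) :
    ∀ᵐ x ∂volD, loadL T W Mstar Nstar Δτ l ω x
      = ∫ s in cell Δτ l, load T W Mstar Nstar ω s x := by
  have h1 : ∀ᵐ x ∂volD, ∀ a ∈ Finset.Icc 1 Nstar ×ˢ Finset.Icc 1 Mstar,
      (noiseCoeff T W (T / Nstar) a.1 a.2 ω • overlap Δτ (T / Nstar) l a.1 • sinL a.2 : L2D) x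
        = noiseCoeff T W (T / Nstar) a.1 a.2 ω * (overlap Δτ (T / Nstar) l a.1 * eps a.2 x) := by
    rw [Filter.eventually_all_finset]
    intro a _
    filter_upwards [Lp.coeFn_smul (noiseCoeff T W (T / Nstar) a.1 a.2 ω)
      (overlap Δτ (T / Nstar) l a.1 • sinL a.2),
      Lp.coeFn_smul (overlap Δτ (T / Nstar) l a.1) (sinL a.2), coeFn_sinL a.2] with x e1 e2 e3
    rw [e1, Pi.smul_apply, e2, Pi.smul_apply, e3, smul_eq_mul, smul_eq_mul]
  filter_upwards [h1, coeFn_finsetSum_L2D (Finset.Icc 1 Nstar ×ˢ Finset.Icc 1 Mstar)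
    fun a => (noiseCoeff T W (T / Nstar) a.1 a.2 ω • overlap Δτ (T / Nstar) l a.1 • sinL a.2 : L2D)]
    with x hx hsum
  unfold loadL load
  rw [hsum, Finset.sum_congr rfl hx, integral_sum_indicator (volume_cell_ne_top _ _),
    Finset.sum_product]
  refine Finset.sum_congr rfl fun n _ => ?_
  rw [Finset.mul_sum, Finset.mul_sum]
  refine Finset.sum_congr rfl fun i _ => ?_
  unfold overlap; ring

lemma inner_loadL (Δτ : ℝ) (l : ℕ) (ω : Ω) (χ : L2D) :
    inner ℝ (loadL T W Mstar Nstar Δτ l ω) χ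
      = ∫ s in cell Δτ l, ∫ x in Ioo (0 : ℝ) 1, load T W Mstar Nstar ω s x * χ x := by
  have hx : ∀ s, ∫ x in Ioo (0 : ℝ) 1, load T W Mstar Nstar ω s x * χ x =
      ∑ n ∈ Finset.Icc 1 Nstar, (cell (T / Nstar) n).indicator (fun _ => (1 / (T / Nstar)) *
        ∑ i ∈ Finset.Icc 1 Mstar, noiseCoeff T W (T / Nstar) n i ω * inner ℝ (sinL i) χ) s := by
    intro s
    have hi : ∀ (c : ℝ) (i : ℕ), Integrable (fun x => c * (eps i x * χ x)) volD := fun c i =>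
      ((memLp_of_continuous (continuous_eps i)).integrable_mul (Lp.memLp χ)).const_mul c
    have e : ∀ n x, (cell (T / Nstar) n).indicator (fun _ => (1 / (T / Nstar)) *
        ∑ i ∈ Finset.Icc 1 Mstar, noiseCoeff T W (T / Nstar) n i ω * eps i x) s * χ x =
        ∑ i ∈ Finset.Icc 1 Mstar, ((cell (T / Nstar) n).indicator (fun _ => (1 / (T / Nstar)) *
          noiseCoeff T W (T / Nstar) n i ω) s) * (eps i x * χ x) := by
      intro n x
      by_cases hs : s ∈ cell (T / Nstar) n
      · simp only [indicator_of_mem hs, Finset.mul_sum, Finset.sum_mul]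
        exact Finset.sum_congr rfl fun i _ => by ring
      · simp [indicator_of_notMem hs]
    simp_rw [load, Finset.sum_mul, e]
    rw [integral_finsetSum _ fun n _ => integrable_finsetSum _ fun i _ => hi _ i]
    refine Finset.sum_congr rfl fun n _ => ?_
    rw [integral_finsetSum _ fun i _ => hi _ i]
    simp_rw [integral_const_mul]
    by_cases hs : s ∈ cell (T / Nstar) n
    · simp only [indicator_of_mem hs, Finset.mul_sum]
      refine Finset.sum_congr rfl fun i _ => ?_
      rw [sinL, integral_toLp_mul]; ring
    · simp [indicator_of_notMem hs]
  simp_rw [hx]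
  rw [integral_sum_indicator (volume_cell_ne_top _ _), loadL, sum_inner, Finset.sum_product]
  refine Finset.sum_congr rfl fun n _ => ?_
  rw [Finset.mul_sum, Finset.mul_sum]
  refine Finset.sum_congr rfl fun i _ => ?_
  rw [real_inner_smul_left, real_inner_smul_left]
  unfold overlap; ring

end Load

/-! ### The mean square error -/

lemma sum_Icc_sub_eq_sum_range (f : ℕ → ℝ) (m : ℕ) :
    ∑ l ∈ Finset.Icc 1 m, f (m - l) = ∑ j ∈ Finset.range m, f j := by
  refine Finset.sum_nbij' (fun l => m - l) (fun j => m - j) ?_ ?_ ?_ ?_ ?_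
  all_goals intro a ha
  all_goals simp only [Finset.mem_Icc, Finset.mem_range] at ha ⊢
  all_goals omega

lemma norm_sum_smul_sq_le {H ι : Type*} [NormedAddCommGroup H] [NormedSpace ℝ H] (s : Finset ι)
    {c : ι → ℝ} (hc : ∀ i ∈ s, 0 ≤ c i) (hc1 : ∑ i ∈ s, c i ≤ 1) (x : ι → H) :
    ‖∑ i ∈ s, c i • x i‖ ^ 2 ≤ ∑ i ∈ s, c i * ‖x i‖ ^ 2 := by
  have h1 : ‖∑ i ∈ s, c i • x i‖ ≤ ∑ i ∈ s, c i * ‖x i‖ :=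
    (norm_sum_le _ _).trans (Finset.sum_le_sum fun i hi => by
      rw [norm_smul, Real.norm_eq_abs, abs_of_nonneg (hc i hi)])
  refine (pow_le_pow_left₀ (norm_nonneg _) h1 2).trans ?_
  have h2 := Finset.sum_sq_le_sum_mul_sum_of_sq_le_mul s (r := fun i => c i * ‖x i‖) hc
    (fun i hi => mul_nonneg (hc i hi) (sq_nonneg ‖x i‖)) (fun i _ => le_of_eq (by ring))
  have h3 : 0 ≤ ∑ i ∈ s, c i * ‖x i‖ ^ 2 :=
    Finset.sum_nonneg fun i hi => mul_nonneg (hc i hi) (sq_nonneg _)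
  nlinarith

/-- Averaging of the noise over the cells of the load does not increase the mean square: the error
operators `D j` are only needed in `ℓ²` of time. -/
lemma sum_overlap_norm_sq_le {H : Type*} [NormedAddCommGroup H] [NormedSpace ℝ H] {Δτ Δt : ℝ}
    (hτ : 0 ≤ Δτ) (ht : 0 < Δt) (D : ℕ → ℕ → H) (Mstar Nstar m : ℕ) :
    Δt * ∑ a ∈ Finset.Icc 1 Nstar ×ˢ Finset.Icc 1 Mstar,
        ‖∑ l ∈ Finset.Icc 1 m, overlap Δτ Δt l a.1 • D (m - l) a.2‖ ^ 2 ≤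
      ∑ i ∈ Finset.Icc 1 Mstar, Δτ * ∑ j ∈ Finset.range m, ‖D j i‖ ^ 2 := by
  calc _ ≤ Δt * ∑ a ∈ Finset.Icc 1 Nstar ×ˢ Finset.Icc 1 Mstar,
        ∑ l ∈ Finset.Icc 1 m, overlap Δτ Δt l a.1 * ‖D (m - l) a.2‖ ^ 2 := by
        refine mul_le_mul_of_nonneg_left (Finset.sum_le_sum fun a _ => ?_) ht.le
        exact norm_sum_smul_sq_le _ (fun l _ => overlap_nonneg ht.le _ _)
          (sum_overlap_left_le hτ ht _ _) _
    _ = ∑ i ∈ Finset.Icc 1 Mstar, ∑ l ∈ Finset.Icc 1 m,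
        (Δt * ∑ n ∈ Finset.Icc 1 Nstar, overlap Δτ Δt l n) * ‖D (m - l) i‖ ^ 2 := by
        rw [Finset.sum_product_right, Finset.mul_sum]
        refine Finset.sum_congr rfl fun i _ => ?_
        rw [Finset.sum_comm, Finset.mul_sum]
        refine Finset.sum_congr rfl fun l _ => ?_
        rw [mul_assoc, Finset.sum_mul]
    _ ≤ ∑ i ∈ Finset.Icc 1 Mstar, ∑ l ∈ Finset.Icc 1 m, Δτ * ‖D (m - l) i‖ ^ 2 :=
        Finset.sum_le_sum fun i _ => Finset.sum_le_sum fun l _ =>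
          mul_le_mul_of_nonneg_right (sum_overlap_right_le hτ ht _ _) (sq_nonneg _)
    _ = _ := by
        refine Finset.sum_congr rfl fun i _ => ?_
        rw [← Finset.mul_sum, sum_Icc_sub_eq_sum_range (fun j => ‖D j i‖ ^ 2)]

section MeanSquare

variable {T : ℝ} {Ω : Type*} [MeasurableSpace Ω] {P : Measure Ω}
  {W : Lp ℝ 2 (volO T) → Ω → ℝ} {Mstar Nstar M : ℕ} {U : ℕ → Ω → L2D}

lemma IsTimeDiscrete.eq_sum (hT : 0 < T) (hM : 0 < M)
    (hU : IsTimeDiscrete T P W Mstar Nstar M U) {R Q : L2D →L[ℝ] L2D}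
    (hR : ∀ x, gram G (R x) + (T / M / 2) • R x = gram G x)
    (hQ : ∀ x, gram G (Q x - x) + (T / M / 2) • (Q x + x) = 0) :
    ∀ᵐ ω ∂P, ∀ m ≤ M, U m ω =
      ∑ l ∈ Finset.Icc 1 m, (Q ^ (m - l)) (R (loadL T W Mstar Nstar (T / M) l ω)) := by
  have hk : 0 < T / M := by positivity
  filter_upwards [hU] with ω hω
  refine cn_solution hk hR hQ (V := fun m => U m ω) hω.1 fun m hm => ?_
  obtain ⟨h1, h2⟩ := hω.2 (m + 1) (Finset.mem_Icc.2 ⟨by omega, by omega⟩)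
  rw [Nat.add_sub_cancel] at h2
  refine timeDiscrete_step h1 ?_ ?_
  · rcases Nat.eq_zero_or_pos m with rfl | hm0
    · rw [hω.1]; exact memHdot_zero 4
    · exact (hω.2 m (Finset.mem_Icc.2 ⟨hm0, by omega⟩)).1
  · refine Lp.ext ?_
    filter_upwards [h2, coeFn_loadL T W Mstar Nstar (T / M) (m + 1) ω] with x e1 e2
    rw [e1, e2]

lemma IsFullyDiscrete.eq_sum (hT : 0 < T) (hM : 0 < M) {p : ℕ} {K : Mesh}
    {S : Submodule ℝ L2D} (hS : IsFESpace p K S)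
    (hU : IsFullyDiscrete T P W Mstar Nstar M S U) {R Q : L2D →L[ℝ] L2D}
    (hR : ∀ x, gram (galerkinG S) (R x) + (T / M / 2) • R x = gram (galerkinG S) x)
    (hQ : ∀ x, gram (galerkinG S) (Q x - x) + (T / M / 2) • (Q x + x) = 0) :
    ∀ᵐ ω ∂P, ∀ m ≤ M, U m ω =
      ∑ l ∈ Finset.Icc 1 m, (Q ^ (m - l)) (R (loadL T W Mstar Nstar (T / M) l ω)) := by
  have hk : 0 < T / M := by positivity
  filter_upwards [hU] with ω hω
  refine cn_solution hk hR hQ (V := fun m => U m ω) hω.1 fun m hm => ?_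
  obtain ⟨h1, h2⟩ := hω.2 (m + 1) (Finset.mem_Icc.2 ⟨by omega, by omega⟩)
  rw [Nat.add_sub_cancel] at h2
  have h3 : U m ω ∈ S := by
    rcases Nat.eq_zero_or_pos m with rfl | hm0
    · rw [hω.1]; exact S.zero_mem
    · exact (hω.2 m (Finset.mem_Icc.2 ⟨hm0, by omega⟩)).1
  refine hS.galerkin_step (S.add_mem h1 h3) fun χ hχ => ?_
  rw [h2 χ hχ, inner_loadL]

/-- The mean square error without any loss in the exponents. -/
theorem mean_square_error_le [IsProbabilityMeasure P] (hT : 0 < T) (hW : IsWhiteNoise T P W)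
    (hN : 0 < Nstar) (hM : 0 < M) {p : ℕ} (hp : p = 2 ∨ p = 3) {K : Mesh}
    {S : Submodule ℝ L2D} (hS : IsFESpace p K S) {Uh : ℕ → Ω → L2D}
    (hU : IsTimeDiscrete T P W Mstar Nstar M U)
    (hUh : IsFullyDiscrete T P W Mstar Nstar M S Uh) {m : ℕ} (hm : m ≤ M) :
    Integrable (fun ω => ‖Uh m ω - U m ω‖ ^ 2) P ∧
      ∫ ω, ‖Uh m ω - U m ω‖ ^ 2 ∂P ≤ 64 * K.h ^ p + 8 * (T / M) ^ (3 / 4 : ℝ) := by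
  have hk : 0 < T / M := by positivity
  have ht : 0 < T / Nstar := by positivity
  obtain ⟨R, Q, hR, hQ⟩ := exists_cn_operators G hk
  obtain ⟨Rh, Qh, hRh, hQh⟩ := exists_cn_operators (galerkinG S) hk
  -- `D j i` is the error after `j + 1` steps, for the load `eps i` in the first step.
  let D : ℕ → ℕ → L2D := fun j i => (Qh ^ j) (Rh (sinL i)) - (Q ^ j) (R (sinL i))
  let v : ℕ × ℕ → L2D := fun a =>
    ∑ l ∈ Finset.Icc 1 m, overlap (T / M) (T / Nstar) l a.1 • D (m - l) a.2
  have hae : ∀ᵐ ω ∂P, ‖Uh m ω - U m ω‖ ^ 2 =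
      ‖∑ a ∈ Finset.Icc 1 Nstar ×ˢ Finset.Icc 1 Mstar,
        noiseCoeff T W (T / Nstar) a.1 a.2 ω • v a‖ ^ 2 := by
    filter_upwards [hU.eq_sum hT hM hR hQ, hUh.eq_sum hT hM hS hRh hQh] with ω h1 h2
    rw [h1 m hm, h2 m hm, ← Finset.sum_sub_distrib]
    simp only [v, D, loadL, map_sum, map_smul, Finset.smul_sum, smul_sub]
    rw [Finset.sum_comm]
    congr 2
    refine Finset.sum_congr rfl fun l _ => ?_
    rw [← Finset.sum_sub_distrib]
  obtain ⟨hi, he⟩ := hW.isometry hT Mstar Nstar v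
  refine ⟨hi.congr (hae.mono fun ω h => h.symm), ?_⟩
  rw [integral_congr_ae hae, he]
  refine (sum_overlap_norm_sq_le hk.le ht D Mstar Nstar m).trans ?_
  refine (Finset.sum_le_sum fun i hi => ?_).trans
    (sum_mode_error_le (pow_pos K.h_pos p) hk
      (E := fun i => ‖sinL i - lam i ^ 4 • gram (galerkinG S) (sinL i)‖)
      (fun i hi => hS.norm_elliptic_error_le hp hi) (fun i => norm_nonneg _) Mstar)
  have hi0 : 0 < i := (Finset.mem_Icc.1 hi).1
  exact sum_error_le hk (isCNOrbit_pow hRh hQh _) (isCNOrbit_pow hR hQ _) (norm_sinL hi0)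
    (pow_pos (lam_pos hi0) 4) (gram_G_sinL hi0) (norm_galerkinG_sinL_sq_le S hi0) m

end MeanSquare

/-- Passage to the form with arbitrarily small losses `ε₁` and `ε₂`, which only weakens the
bound. -/
lemma rate_le {T h k X : ℝ} {p : ℕ} (hp : p ≤ 3) (hT : 0 < T) (hh : 0 < h) (hh1 : h ≤ 1)
    (hk : 0 < k) (hkT : k ≤ T) (hX : X ≤ 64 * h ^ p + 8 * k ^ (3 / 4 : ℝ))
    {ε₁ ε₂ : ℝ} (h₁ : ε₁ ∈ Ioc (0 : ℝ) ((p : ℝ) / 2)) (h₂ : ε₂ ∈ Ioc (0 : ℝ) (3 / 8)) :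
    X ^ (1 / 2 : ℝ) ≤ (16 + 3 * (1 + T)) *
      (ε₁ ^ (-(1 / 2) : ℝ) * h ^ ((p : ℝ) / 2 - ε₁) + ε₂ ^ (-(1 / 2) : ℝ) * k ^ (3 / 8 - ε₂)) := by
  have hp' : (p : ℝ) ≤ 3 := by exact_mod_cast hp
  set A := h ^ ((p : ℝ) / 2) with hA
  set B := k ^ (3 / 8 : ℝ) with hB
  have hA0 : 0 < A := Real.rpow_pos_of_pos hh _
  have hB0 : 0 < B := Real.rpow_pos_of_pos hk _
  have hA2 : A ^ 2 = h ^ p := by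
    rw [hA, ← Real.rpow_natCast, ← Real.rpow_mul hh.le, ← Real.rpow_natCast h p]
    congr 1; push_cast; ring
  have hB2 : B ^ 2 = k ^ (3 / 4 : ℝ) := by
    rw [hB, ← Real.rpow_natCast, ← Real.rpow_mul hk.le]; norm_num
  have hroot : X ^ (1 / 2 : ℝ) ≤ 8 * A + 3 * B := by
    rw [← Real.sqrt_eq_rpow]
    refine Real.sqrt_le_iff.2 ⟨by positivity, hX.trans ?_⟩
    rw [← hA2, ← hB2]
    nlinarith [mul_pos hA0 hB0]
  have hε₁ : 1 / 2 ≤ ε₁ ^ (-(1 / 2) : ℝ) := by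
    calc (1 / 2 : ℝ) = (4 : ℝ) ^ (-(1 / 2) : ℝ) := by
          rw [Real.rpow_neg (by norm_num), ← Real.sqrt_eq_rpow,
            show (4 : ℝ) = 2 ^ 2 by norm_num, Real.sqrt_sq (by norm_num)]
          norm_num
      _ ≤ ε₁ ^ (-(1 / 2) : ℝ) :=
          Real.rpow_le_rpow_of_nonpos h₁.1 (by linarith [h₁.2]) (by norm_num)
  have hε₂ : 1 ≤ ε₂ ^ (-(1 / 2) : ℝ) :=
    Real.one_le_rpow_of_pos_of_le_one_of_nonpos h₂.1 (by linarith [h₂.2]) (by norm_num)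
  have hAle : A ≤ h ^ ((p : ℝ) / 2 - ε₁) :=
    Real.rpow_le_rpow_of_exponent_ge hh hh1 (by linarith [h₁.1])
  have hBle : B ≤ (1 + T) * k ^ (3 / 8 - ε₂) := by
    have h3 : B = k ^ ε₂ * k ^ (3 / 8 - ε₂) := by
      rw [hB, ← Real.rpow_add hk]; congr 1; ring
    rw [h3]
    refine mul_le_mul_of_nonneg_right ?_ (Real.rpow_nonneg hk.le _)
    calc k ^ ε₂ ≤ (1 + T) ^ ε₂ := Real.rpow_le_rpow hk.le (by linarith) h₂.1.le
      _ ≤ (1 + T) ^ (1 : ℝ) :=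
          Real.rpow_le_rpow_of_exponent_le (by linarith) (by linarith [h₂.2])
      _ = 1 + T := Real.rpow_one _
  have hA' : A ≤ 2 * (ε₁ ^ (-(1 / 2) : ℝ) * h ^ ((p : ℝ) / 2 - ε₁)) := by nlinarith
  have hk0 : 0 < k ^ (3 / 8 - ε₂) := Real.rpow_pos_of_pos hk _
  have hB' : B ≤ (1 + T) * (ε₂ ^ (-(1 / 2) : ℝ) * k ^ (3 / 8 - ε₂)) :=
    hBle.trans (mul_le_mul_of_nonneg_left (le_mul_of_one_le_left hk0.le hε₂) (by linarith))
  have ha0 : 0 ≤ ε₁ ^ (-(1 / 2) : ℝ) * h ^ ((p : ℝ) / 2 - ε₁) := by linarith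
  have hb0 : 0 ≤ ε₂ ^ (-(1 / 2) : ℝ) * k ^ (3 / 8 - ε₂) := by positivity
  nlinarith

end

end CNFEM

theorem mainTheorem4 (T : ℝ) (hT : 0 < T) (p : ℕ) (hp : p = 2 ∨ p = 3) :
    ∃ C : ℝ, 0 < C ∧
      ∀ (Ω : Type*) [MeasurableSpace Ω] (P : Measure Ω) [IsProbabilityMeasure P]
        (W : Lp ℝ 2 (CNFEM.volO T) → Ω → ℝ), CNFEM.IsWhiteNoise T P W →
      ∀ Mstar Nstar M : ℕ, 0 < Mstar → 0 < Nstar → 0 < M →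
      ∀ (K : CNFEM.Mesh) (S : Submodule ℝ CNFEM.L2D), CNFEM.IsFESpace p K S →
      ∀ U Uh : ℕ → Ω → CNFEM.L2D,
        CNFEM.IsTimeDiscrete T P W Mstar Nstar M U →
        CNFEM.IsFullyDiscrete T P W Mstar Nstar M S Uh →
      ∀ m ∈ Finset.Icc 1 M,
        Integrable (fun ω => ‖Uh m ω - U m ω‖ ^ 2) P ∧
        ∀ ε₁ ∈ Ioc (0 : ℝ) ((p : ℝ) / 2), ∀ ε₂ ∈ Ioc (0 : ℝ) (3 / 8),
          (∫ ω, ‖Uh m ω - U m ω‖ ^ 2 ∂P) ^ (1 / 2 : ℝ) ≤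
            C * (ε₁ ^ (-(1 / 2) : ℝ) * K.h ^ ((p : ℝ) / 2 - ε₁)
              + ε₂ ^ (-(1 / 2) : ℝ) * (T / M) ^ (3 / 8 - ε₂)) := by
  refine ⟨16 + 3 * (1 + T), by linarith, ?_⟩
  intro Ω _ P _ W hW Mstar Nstar M _ hN hM K S hS U Uh hU hUh m hm
  obtain ⟨hint, hle⟩ :=
    CNFEM.mean_square_error_le hT hW hN hM hp hS hU hUh (Finset.mem_Icc.1 hm).2
  refine ⟨hint, fun ε₁ h₁ ε₂ h₂ => ?_⟩
  have hM1 : (1 : ℝ) ≤ M := by exact_mod_cast hM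
  exact CNFEM.rate_le (by omega) hT K.h_pos K.h_le_one (by positivity)
    (div_le_self hT.le hM1) hle h₁ h₂
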